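/- Let $q\ge 5$ be a prime, $\mathbb F=\mathbb Z/q\mathbb Z$, $k\ge 0$ an integer, and let $\zeta_e$ be the quadratic character of $\mathbb F^*$. Let $\rho(\zeta_e)$ be the principal series representation of $SL_2(\mathbb F)$, that is, the representation induced from the character $\begin{pmatrix} a&b\\0&a^{-1}\end{pmatrix}\mapsto\zeta_e(a)$ of the upper triangular subgroup. It decomposes as $\rho(\zeta_e)=\rho(\zeta_e)^+\oplus\rho(\zeta_e)^-$ into two inequivalent irreducible representations, labelled so that the character of $\rho(\zeta_e)^{\pm}$ takes the value $\frac12\bigl(1\pm\sqrt{q\,\zeta_e(-1)}\bigr)$ at $\begin{pmatrix}1&1\\0&1\end{pmatrix}$, where $\sqrt{q}>0$ and $\sqrt{-q}=i\sqrt q$. For a representation $(\rho,V)$ of $SL_2(\mathbb F)$, viewed as a representation of $SL_2(\mathbb Z)$ by reduction modulo $q$, let $\mathcal S_k(SL_2(\mathbb Z),\rho)$ be the space of functions $f$ from the upper half plane to $V$ whose coordinates are cusp forms of weight $k$ for the kernel of $\rho$ in $SL_2(\mathbb Z)$ and which satisfy $f(\gamma z)=j(\gamma,z)^k\rho(\gamma)f(z)$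 for all $\gamma\in SL_2(\mathbb Z)$, where $j\left(\begin{pmatrix}a&b\\c&d\end{pmatrix},z\right)=cz+d$. Let $SL_2(\mathbb Z)$ act on functions on the upper half plane by $[\sigma(g)f](z)=j(g^{-1},z)^{-k}f(g^{-1}z)$. Let $\mathcal S_k(\Gamma_0(q),\zeta_e)$ be the space of $f\in\mathcal S_k(\Gamma_1(q))$ with $\sigma(g)f=\zeta_e(d)f$ for all $g=\begin{pmatrix}a&b\\c&d\end{pmatrix}\in\Gamma_0(q)$, and for $n\in\mathbb F$ let $\mathcal S_k(\Gamma_1(q),\psi_n)$ be the space of $f\in\mathcal S_k(\Gamma(q))$ with $\sigma(g)f=e^{2\pi i nb/q}f$ for all $g=\begin{pmatrix}a&b\\c&d\end{pmatrix}\in\Gamma_1(q)$. If $\zeta_e(-1)\ne(-1)^k$, then $\mathcal S_k(SL_2(\mathbb Z),\rho(\zeta_e)^{\pm})=0$. If $\zeta_e(-1)=(-1)^k$, then the spaces $\mathcal S_k(SL_2(\mathbb Z),\rho(\zeta_e)^{\pm})$, $\mathcal S_k(\Gamma_0(q),\zeta_e)$ and $\mathcal S_k(\Gamma_1(q),\psi_n)$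 ($n\in\mathbb F^*$) are finite-dimensional over $\mathbb C$, and $$\dim \mathcal S_k(SL_2(\mathbb Z),\rho(\zeta_e)^{\pm})=\frac12\dim\mathcal S_k(\Gamma_0(q),\zeta_e)\pm\frac{\zeta_e(-1)}{q-1}\sum_{n\in\mathbb F^*}\zeta_e(n)\dim\mathcal S_k(\Gamma_1(q),\psi_n).$$ -/

import Mathlib

open UpperHalfPlane ModularForm CongruenceSubgroup
open scoped MatrixGroups

noncomputable section

namespace CuspRep

/-! ### Representations of `SL₂(𝔽_q)` -/

section Representations

variable (q : ℕ)

/-- The reduction map `SL₂(ℤ) → SL₂(ℤ/q)`. -/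
def reduction : SL(2, ℤ) →* SL(2, ZMod q) :=
  Matrix.SpecialLinearGroup.map (Int.castRingHom (ZMod q))

/-- The Borel subgroup of upper triangular matrices in `SL₂(ℤ/q)`. -/
def borel : Subgroup SL(2, ZMod q) where
  carrier := {g | g 1 0 = 0}
  one_mem' := by simp
  mul_mem' {a b} ha hb := by
    simp only [Set.mem_ofPred_eq] at *
    simp [Matrix.mul_apply, Fin.sum_univ_two, ha, hb]
  inv_mem' {a} ha := by
    simp only [Set.mem_ofPred_eq] at *
    simp [Matrix.SpecialLinearGroup.SL2_inv_expl a, ha]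

/-- The character `(a, b; 0, a⁻¹) ↦ α(a)` of the Borel subgroup, as a one-dimensional
representation; it extends `α` from the diagonal torus and is trivial on the unipotent radical. -/
def borelChar (α : MulChar (ZMod q) ℂ) : Representation ℂ (borel q) ℂ where
  toFun b := α (b.1 0 0) • LinearMap.id
  map_one' := by ext; simp
  map_mul' a b := by
    have hb : b.1 1 0 = 0 := b.2
    ext
    simp [Matrix.mul_apply, Fin.sum_univ_two, hb, mul_comm]

/-- The space of the principal series representation `ρ(α)`: the functions `φ` on `SL₂(ℤ/q)` with
`φ(b x) = α(b) φ(x)` for all `b` in the Borel subgroup. -/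
def PrincipalSeriesSpace (α : MulChar (ZMod q) ℂ) : Type :=
  Representation.coindV (borel q).subtype (borelChar q α)

instance (α : MulChar (ZMod q) ℂ) : AddCommGroup (PrincipalSeriesSpace q α) :=
  inferInstanceAs (AddCommGroup (Representation.coindV (borel q).subtype (borelChar q α)))

instance (α : MulChar (ZMod q) ℂ) : Module ℂ (PrincipalSeriesSpace q α) :=
  inferInstanceAs (Module ℂ (Representation.coindV (borel q).subtype (borelChar q α)))

/-- The principal series representation `ρ(α)` of `SL₂(ℤ/q)`, induced from the character `α` of
the Borel subgroup; the group acts by right translation. -/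
def principalSeries (α : MulChar (ZMod q) ℂ) :
    Representation ℂ SL(2, ZMod q) (PrincipalSeriesSpace q α) :=
  Representation.coind (borel q).subtype (borelChar q α)

/-- The unipotent matrix `(1, 1; 0, 1)` in `SL₂(ℤ/q)`. -/
def unipotent : SL(2, ZMod q) := ⟨!![1, 1; 0, 1], by simp⟩

variable [Fact q.Prime]

/-- The quadratic character `ζ_e` of `𝔽_q`, with complex values. -/
def quadChar : MulChar (ZMod q) ℂ :=
  (quadraticChar (ZMod q)).ringHomComp (Int.castRingHom ℂ)

/-- The square root `√(q ζ_e(-1))`, principal branch: it is `√q` if `ζ_e(-1) = 1` and `i√q` if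
`ζ_e(-1) = -1`. -/
def sqrtQEps : ℂ := ((q : ℂ) * quadChar q (-1)) ^ (1 / 2 : ℂ)

/-- `W` is an irreducible subrepresentation of `ρ(ζ_e)` whose character takes the value
`(1 ± √(q ζ_e(-1))) / 2` at `(1, 1; 0, 1)`, where `±` is the sign `s`. -/
def IsHalfConstituent (s : ℤˣ) (W : Subrepresentation (principalSeries q (quadChar q))) : Prop :=
  W.toRepresentation.IsIrreducible ∧
    W.toRepresentation.character (unipotent q) = (1 + ((s : ℤ) : ℂ) * sqrtQEps q) / 2

/-- The representation `ρ(ζ_e)^±` (with `±` the sign `s`) as a subrepresentation of `ρ(ζ_e)`.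
The representation `ρ(ζ_e)` is the direct sum of two inequivalent irreducible representations,
whose characters take the values `(1 ± √(q ζ_e(-1))) / 2` at `(1, 1; 0, 1)`. So, for each sign,
exactly one `W` contributes to the supremum below, and it is the constituent with this sign. -/
def quadConstituent (s : ℤˣ) : Subrepresentation (principalSeries q (quadChar q)) where
  toSubmodule := ⨆ (W : Subrepresentation (principalSeries q (quadChar q)))
    (_ : IsHalfConstituent q s W), W.toSubmodule
  apply_mem_toSubmodule g v hv := by
    have h : (⨆ (W : Subrepresentation (principalSeries q (quadChar q)))
        (_ : IsHalfConstituent q s W), W.toSubmodule) ≤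
        (⨆ (W : Subrepresentation (principalSeries q (quadChar q)))
        (_ : IsHalfConstituent q s W), W.toSubmodule).comap (principalSeries q (quadChar q) g) :=
      iSup₂_le fun W hW _ hx =>
        (le_iSup₂ (f := fun (W : Subrepresentation (principalSeries q (quadChar q)))
          (_ : IsHalfConstituent q s W) => W.toSubmodule) W hW) (W.apply_mem_toSubmodule g hx)
    exact h hv

/-- The space of the representation `ρ(ζ_e)^±`, with `±` the sign `s`. -/
def QuadSpace (s : ℤˣ) : Type := (quadConstituent q s).toSubmodule

instance (s : ℤˣ) : AddCommGroup (QuadSpace q s) :=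
  inferInstanceAs (AddCommGroup (quadConstituent q s).toSubmodule)

instance (s : ℤˣ) : Module ℂ (QuadSpace q s) :=
  inferInstanceAs (Module ℂ (quadConstituent q s).toSubmodule)

/-- The representation `ρ(ζ_e)^±` of `SL₂(𝔽_q)`, with `±` the sign `s`. -/
def rhoQuad (s : ℤˣ) : Representation ℂ SL(2, ZMod q) (QuadSpace q s) :=
  (quadConstituent q s).toRepresentation

end Representations

/-! ### Spaces of cusp forms -/

/-- The space `S_k(SL₂(ℤ), ρ)` of vector-valued cusp forms, for a representation `ρ` of `SL₂(ℤ)`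
whose kernel has finite index: the functions `f : ℍ → V` all of whose coordinates are cusp forms of
weight `k` for `ker ρ`, and with `f(γ z) = j(γ, z)^k ρ(γ) f(z)` for all `γ ∈ SL₂(ℤ)`. -/
def vectorCuspForms {V : Type*} [AddCommGroup V] [Module ℂ V] (k : ℤ)
    (ρ : Representation ℂ SL(2, ℤ) V) : Submodule ℂ (ℍ → V) where
  carrier := {f |
    (∀ ℓ : V →ₗ[ℂ] ℂ, ∃ F : CuspForm ((MonoidHom.ker ρ : Subgroup SL(2, ℤ)) :
      Subgroup (GL (Fin 2) ℝ)) k, ⇑F = fun z => ℓ (f z)) ∧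
    ∀ (γ : SL(2, ℤ)) (z : ℍ), f (γ • z) = denom γ z ^ k • ρ γ (f z)}
  zero_mem' := ⟨fun _ => ⟨0, by ext; simp⟩, fun _ _ => by simp⟩
  add_mem' := by
    rintro f g ⟨hf, hf'⟩ ⟨hg, hg'⟩
    refine ⟨fun ℓ => ?_, fun γ z => by
      rw [Pi.add_apply, Pi.add_apply, hf', hg', map_add, smul_add]⟩
    obtain ⟨F, hF⟩ := hf ℓ
    obtain ⟨G, hG⟩ := hg ℓ
    exact ⟨F + G, by ext z; simp [hF, hG]⟩
  smul_mem' := by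
    rintro c f ⟨hf, hf'⟩
    refine ⟨fun ℓ => ?_, fun γ z => by
      rw [Pi.smul_apply, Pi.smul_apply, hf', map_smul, smul_comm]⟩
    obtain ⟨F, hF⟩ := hf ℓ
    exact ⟨c • F, by ext z; simp [hF]⟩

/-- The space `S_k(SL₂(ℤ), ρ)` for a representation `ρ` of `SL₂(ℤ/q)`, seen as a representation
of `SL₂(ℤ)` through the reduction map. -/
def cuspFormsRep {V : Type*} [AddCommGroup V] [Module ℂ V] (q : ℕ) (k : ℤ)
    (ρ : Representation ℂ SL(2, ZMod q) V) : Submodule ℂ (ℍ → V) :=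
  vectorCuspForms k (MonoidHom.comp ρ (reduction q))

/-- The cusp forms `f` of weight `k` for `Δ` on which each `g ∈ Γ` acts by the scalar `χ g`, under
the left action `σ(g) f = f ∣[k] g⁻¹`, that is, `(σ(g) f)(z) = j(g⁻¹, z)^(-k) f(g⁻¹ z)`. -/
def eigenCuspForms (Δ Γ : Subgroup SL(2, ℤ)) (k : ℤ) (χ : SL(2, ℤ) → ℂ) :
    Submodule ℂ (CuspForm (Δ : Subgroup (GL (Fin 2) ℝ)) k) where
  carrier := {f | ∀ g ∈ Γ, ⇑f ∣[k] g⁻¹ = χ g • ⇑f}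
  zero_mem' := fun g _ => by simp
  add_mem' := by
    intro f f' hf hf' g hg
    simp only [Set.mem_ofPred_eq] at hf hf'
    simp [hf g hg, hf' g hg]
  smul_mem' := by
    intro c f hf g hg
    simp only [Set.mem_ofPred_eq] at hf
    rw [FunLike.coe_smul, SL_smul_slash, hf g hg, smul_comm]

/-- The space `S_k(Γ₀(q), φ)` of cusp forms for `Γ₁(q)` on which `(a, b; c, d) ∈ Γ₀(q)` acts by
`φ(d)`. -/
def cuspFormsGamma0 (q : ℕ) (k : ℤ) (φ : MulChar (ZMod q) ℂ) :
    Submodule ℂ (CuspForm (Gamma1 q : Subgroup (GL (Fin 2) ℝ)) k) :=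
  eigenCuspForms (Gamma1 q) (Gamma0 q) k fun g => φ (g 1 1 : ZMod q)

/-- The space `S_k(Γ₁(q), ψ_n)` of cusp forms for `Γ(q)` on which `(a, b; c, d) ∈ Γ₁(q)` acts by
`ψ_n(b) = exp(2πi n b / q)`. -/
def cuspFormsGamma1 (q : ℕ) [NeZero q] (k : ℤ) (n : ZMod q) :
    Submodule ℂ (CuspForm (Gamma q : Subgroup (GL (Fin 2) ℝ)) k) :=
  eigenCuspForms (Gamma q) (Gamma1 q) k fun g => ZMod.stdAddChar (n * (g 0 1 : ZMod q))

end CuspRep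

end

noncomputable section

namespace CuspRep

/-! ### Elements of `SL₂(𝔽_q)` -/

/-! Let `G = SL₂(𝔽_q)`, let `B` be its upper triangular subgroup, `w` the Weyl element, `uₓ = (1, x;
0, 1)`, and let `π` be the representation of `G` on the cusp forms for `Γ(q)` (`formsRep`). The
operator `T = ζ_e(-1) ∑ₓ π(uₓ w)` (`hecke`) preserves the `(B, ζ_e)`-vectors and satisfies `T² = q
ζ_e(-1)` on them (`hecke_hecke`), so they split into the eigenspaces for `z = ±√(q ζ_e(-1))`.

Built from left translations on functions on `G`, the same operator is an intertwining operator of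
`ρ(ζ_e)`. Its two eigenspaces are irreducible with character `(1 + z) / 2` at `u₁`, hence they are
`ρ(ζ_e)^±` (`quadConstituent_eq`). By Frobenius reciprocity, `h ↦ (τ ↦ (x ↦ (π(x⁻¹) h)(τ)))`
identifies the `z`-eigenspace of `T` in the `(B, ζ_e)`-vectors of `π` with the vector-valued forms
(`heckeEigenEquiv`). All the `(B, ζ_e)`-vectors together form `S_k(Γ₀(q), ζ_e)`, and the
`ψ_n`-vectors of the unipotent radical form `S_k(Γ₁(q), ψ_n)`.

With `P` the projection onto the `(B, ζ_e)`-vectors, the dimension sought is the trace of `(P + z⁻¹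
T P) / 2`. The trace of `T P` is a sum of `ζ_e(a) tr π(g)` over matrices `g` with parameter `a` and
trace `t`. For `t ≠ ±2` they are all conjugate and the sum over `a` vanishes. What remains is `2 ∑ₓ
ζ_e(x) tr π(uₓ)`, which Fourier inversion turns into the Gauss sum times `∑ₙ ζ_e(n) dim` of the
`ψ_n`-eigenspaces (`finrank_heckeEigen`). Parity enters here, because `-1` has to act by `ζ_e(-1)`.

The correction term thus carries the factor `g / z` with `g` the Gauss sum, and the sign in the
formula is exactly Gauss's theorem `g = √(q ζ_e(-1))` (`gaussSum_quadChar`). Its proof compares `g`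
with a product of differences of roots of unity having the same square: a congruence modulo `q`
fixes the relative sign, and the product is evaluated through sines. -/

lemma SL2_ext {q : ℕ} {g h : SL(2, ZMod q)} (h00 : g 0 0 = h 0 0) (h01 : g 0 1 = h 0 1)
    (h10 : g 1 0 = h 1 0) (h11 : g 1 1 = h 1 1) : g = h := by
  ext i j
  fin_cases i <;> fin_cases j <;> assumption

section Elements

variable {q : ℕ} [Fact q.Prime]

/-- The matrix `(a, b; c, d)` of determinant one. -/
def sl2 (a b c d : ZMod q) (h : a * d - b * c = 1) : SL(2, ZMod q) :=
  ⟨!![a, b; c, d], by rw [Matrix.det_fin_two_of, h]⟩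

/-- The matrix `(1, x; 0, 1)`. -/
def upper (x : ZMod q) : SL(2, ZMod q) := sl2 1 x 0 1 (by simp)

variable (q) in
/-- The Weyl element `(0, 1; -1, 0)`. -/
def weyl : SL(2, ZMod q) := sl2 0 1 (-1) 0 (by simp)

/-- The matrix `(a, c; 0, a⁻¹)`. -/
def borelElt (a : (ZMod q)ˣ) (c : ZMod q) : SL(2, ZMod q) :=
  sl2 a c 0 (a : ZMod q)⁻¹ (by simp [-ZMod.inv_coe_unit])

/-- The matrix `(0, a⁻¹; -a, t)`, a conjugate of a companion matrix with trace `t`. -/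
def companion (a : (ZMod q)ˣ) (t : ZMod q) : SL(2, ZMod q) :=
  sl2 0 (a : ZMod q)⁻¹ (-a) t (by simp [-ZMod.inv_coe_unit])

lemma SL2_mul_apply (g h : SL(2, ZMod q)) (i j : Fin 2) :
    (g * h) i j = g i 0 * h 0 j + g i 1 * h 1 j := by
  simp [Matrix.mul_apply, Fin.sum_univ_two]

section entries
variable {a' b' c' d' : ZMod q} (h : a' * d' - b' * c' = 1)
@[simp] lemma sl2_00 : sl2 a' b' c' d' h 0 0 = a' := rfl
@[simp] lemma sl2_01 : sl2 a' b' c' d' h 0 1 = b' := rfl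
@[simp] lemma sl2_10 : sl2 a' b' c' d' h 1 0 = c' := rfl
@[simp] lemma sl2_11 : sl2 a' b' c' d' h 1 1 = d' := rfl
variable (x : ZMod q) (a : (ZMod q)ˣ) (c : ZMod q)
@[simp] lemma upper_00 : upper x 0 0 = 1 := rfl
@[simp] lemma upper_01 : upper x 0 1 = x := rfl
@[simp] lemma upper_10 : upper x 1 0 = 0 := rfl
@[simp] lemma upper_11 : upper x 1 1 = 1 := rfl
@[simp] lemma weyl_00 : weyl q 0 0 = 0 := rfl
@[simp] lemma weyl_01 : weyl q 0 1 = 1 := rfl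
@[simp] lemma weyl_10 : weyl q 1 0 = -1 := rfl
@[simp] lemma weyl_11 : weyl q 1 1 = 0 := rfl
@[simp] lemma borelElt_00 : borelElt a c 0 0 = a := rfl
@[simp] lemma borelElt_01 : borelElt a c 0 1 = c := rfl
@[simp] lemma borelElt_10 : borelElt a c 1 0 = 0 := rfl
@[simp] lemma borelElt_11 : borelElt a c 1 1 = (a : ZMod q)⁻¹ := rfl
@[simp] lemma companion_00 : companion a c 0 0 = 0 := rfl
@[simp] lemma companion_01 : companion a c 0 1 = (a : ZMod q)⁻¹ := rfl
@[simp] lemma companion_10 : companion a c 1 0 = -a := rfl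
@[simp] lemma companion_11 : companion a c 1 1 = c := rfl
end entries

lemma upper_zero : upper (0 : ZMod q) = 1 := by
  apply SL2_ext <;> simp [-ZMod.inv_coe_unit]

lemma upper_mul_upper (x y : ZMod q) : upper x * upper y = upper (x + y) := by
  apply SL2_ext <;> simp [SL2_mul_apply, add_comm]

lemma borelElt_one (x : ZMod q) : borelElt 1 x = upper x := by
  apply SL2_ext <;> simp [-ZMod.inv_coe_unit]

lemma borelElt_mul (a b : (ZMod q)ˣ) (c d : ZMod q) :
    borelElt a c * borelElt b d = borelElt (a * b) (a * d + c * (b : ZMod q)⁻¹) := by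
  apply SL2_ext <;> simp [SL2_mul_apply, mul_comm, -ZMod.inv_coe_unit]

lemma borelElt_mul_upper (a : (ZMod q)ˣ) (c x : ZMod q) :
    borelElt a c * upper x = borelElt a (a * x + c) := by
  apply SL2_ext <;> simp [SL2_mul_apply, -ZMod.inv_coe_unit]

lemma borelElt_mul_upper_mul_weyl (a : (ZMod q)ˣ) (c x : ZMod q) :
    borelElt a c * (upper x * weyl q) =
      upper ((a : ZMod q) * c + (a : ZMod q) * (a : ZMod q) * x) * weyl q * borelElt a⁻¹ 0 := by
  have := a.ne_zero
  apply SL2_ext <;> simp [SL2_mul_apply, -ZMod.inv_coe_unit] <;> field_simp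

lemma upper_mul_borelElt (a : (ZMod q)ˣ) (c x : ZMod q) :
    upper x * borelElt a c = borelElt a c * upper ((a : ZMod q)⁻¹ * (a : ZMod q)⁻¹ * x) := by
  have := a.ne_zero
  apply SL2_ext <;> simp [SL2_mul_apply, -ZMod.inv_coe_unit]
  · field_simp
    ring

lemma weyl_mul_weyl : weyl q * weyl q = -1 := by
  apply SL2_ext <;> simp [SL2_mul_apply, -ZMod.inv_coe_unit]

lemma weyl_mul_upper_mul_weyl (y : (ZMod q)ˣ) :
    weyl q * (upper (y : ZMod q) * weyl q) =
      borelElt (-y)⁻¹ 1 * (weyl q * upper (-(y : ZMod q)⁻¹)) := by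
  have := y.ne_zero
  apply SL2_ext <;> simp [SL2_mul_apply, -ZMod.inv_coe_unit]

lemma weyl_mul_borelElt (a : (ZMod q)ˣ) (c : ZMod q) :
    weyl q * borelElt a c = companion a (-c) := by
  apply SL2_ext <;> simp [SL2_mul_apply, -ZMod.inv_coe_unit]

lemma neg_one_eq_borelElt : (-1 : SL(2, ZMod q)) = borelElt (-1) 0 := by
  apply SL2_ext <;> simp [-ZMod.inv_coe_unit]

/-! ### Conjugacy of matrices with given trace -/

lemma mul_upper_eq_companion_mul (a : (ZMod q)ˣ) :
    ∃ g : SL(2, ZMod q), g * upper (a : ZMod q) = companion a 2 * g := by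
  have := a.ne_zero
  refine ⟨sl2 (a : ZMod q)⁻¹ (-1) 1 0 (by ring), ?_⟩
  apply SL2_ext <;> simp [SL2_mul_apply, -ZMod.inv_coe_unit] <;> field_simp <;> ring

lemma companion_neg_two (a : (ZMod q)ˣ) : companion a (-2) = -1 * companion (-a) 2 := by
  apply SL2_ext <;> simp [-ZMod.inv_coe_unit]

/-- The form has nonzero discriminant `t² - 4`. Completing the square makes it `x² + (1 - t²/4) y²`,
and the values of two quadratic polynomials over a finite field of odd order always meet by
counting. -/
lemma exists_quadratic_form_eq (hq : q ≠ 2) {t : ZMod q} (ht : t ^ 2 ≠ 4) (c : ZMod q) :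
    ∃ x y : ZMod q, x ^ 2 + t * x * y + y ^ 2 = c := by
  have h2 : (2 : ZMod q) ≠ 0 := Ring.two_ne_zero (by rwa [ZMod.ringChar_zmod_n])
  have h4 : (1 - (t / 2) ^ 2 : ZMod q) ≠ 0 := by
    intro h
    apply ht
    field_simp at h
    linear_combination -h
  obtain ⟨x, y, h⟩ := FiniteField.exists_root_sum_quadratic (R := ZMod q)
    (f := Polynomial.X ^ 2 - Polynomial.C c)
    (g := Polynomial.C (1 - (t / 2) ^ 2) * Polynomial.X ^ 2)
    (Polynomial.degree_X_pow_sub_C (by norm_num) _) (Polynomial.degree_C_mul_X_pow _ h4)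
    (by rw [ZMod.card]; exact Nat.odd_iff.mp ((Fact.out : q.Prime).odd_of_ne_two hq))
  refine ⟨x - t / 2 * y, y, ?_⟩
  simp at h
  field_simp at h ⊢
  linear_combination h

/-- The matrices intertwining the two companion matrices form a plane, parametrised by `x` and `y`,
on which the determinant is `a (x² + t x y + y²)`. So an intertwiner in `SL₂` exists as soon as this
form represents `a⁻¹`. -/
lemma exists_mul_companion_eq (hq : q ≠ 2) {t : ZMod q} (ht : t ^ 2 ≠ 4) (a : (ZMod q)ˣ) :
    ∃ g : SL(2, ZMod q), g * companion 1 t = companion a t * g := by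
  have := a.ne_zero
  obtain ⟨x, y, h⟩ := exists_quadratic_form_eq hq ht ((a : ZMod q)⁻¹)
  refine ⟨sl2 x y (-(a * y)) (a * (x + t * y)) ?_, ?_⟩
  · field_simp at h
    linear_combination h
  · apply SL2_ext <;> simp [SL2_mul_apply, -ZMod.inv_coe_unit] <;> field_simp <;> ring

/-! ### Values and sums of the quadratic character -/

lemma quadChar_sq (a : (ZMod q)ˣ) : quadChar q a * quadChar q a = 1 := by
  have := quadraticChar_sq_one (a := (a : ZMod q)) a.ne_zero
  rw [quadChar, MulChar.ringHomComp_apply, ← map_mul, ← sq, this, map_one]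

lemma quadChar_inv (a : (ZMod q)ˣ) : quadChar q (a⁻¹ : (ZMod q)ˣ) = quadChar q a := by
  have h : quadChar q (a⁻¹ : (ZMod q)ˣ) * quadChar q a = 1 := by
    rw [← map_mul, Units.inv_mul, map_one]
  rw [← mul_one (quadChar q (a⁻¹ : (ZMod q)ˣ)), ← quadChar_sq a, ← mul_assoc, h, one_mul]

lemma quadChar_neg_one_sq : quadChar q (-1) * quadChar q (-1) = 1 := by
  simpa using quadChar_sq (-1 : (ZMod q)ˣ)

lemma quadChar_isQuadratic : (quadChar q).IsQuadratic :=
  (quadraticChar_isQuadratic (ZMod q)).comp _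

lemma quadChar_ne_one (hq : q ≠ 2) : quadChar q ≠ 1 := by
  have h := quadraticChar_ne_one (F := ZMod q) (by rwa [ZMod.ringChar_zmod_n])
  exact (MulChar.ringHomComp_ne_one_iff (RingHom.injective_int _)).mpr h

lemma sum_units_quadChar_mul (f : ZMod q → ℂ) :
    ∑ a : (ZMod q)ˣ, quadChar q a * f a = ∑ a, quadChar q a * f a := by
  classical
  rw [← Finset.sum_erase (a := (0 : ZMod q)) Finset.univ (by simp [MulChar.map_zero])]
  refine Finset.sum_bij (fun a _ => (a : ZMod q)) (fun a _ => by simp [a.ne_zero])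
    (fun a _ b _ h => Units.ext h) (fun b hb => ?_) fun _ _ => rfl
  exact ⟨Units.mk0 b (by simpa using hb), by simp, rfl⟩

lemma sum_units_quadChar (hq : q ≠ 2) : ∑ a : (ZMod q)ˣ, quadChar q a = 0 := by
  simpa using (sum_units_quadChar_mul (q := q) 1).trans
    (by simpa using MulChar.sum_eq_zero_of_ne_one (quadChar_ne_one hq))

end Elements

/-! ### The Hecke operator on the `(B, ζ_e)`-eigenspace of a representation -/

section Hecke

lemma character_eq_of_conj {G V : Type*} [Group G] [AddCommGroup V] [Module ℂ V]
    (π : Representation ℂ G V) {g h k : G} (e : k * g = h * k) :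
    π.character g = π.character h := by
  rw [← π.char_conj g k, e, mul_inv_cancel_right]

variable {q : ℕ} [Fact q.Prime] {V : Type*} [AddCommGroup V] [Module ℂ V]
  (π : Representation ℂ SL(2, ZMod q) V)

/-- The vectors on which the Borel subgroup acts through the quadratic character. -/
def borelEigen : Submodule ℂ V where
  carrier := {v | ∀ a c, π (borelElt a c) v = quadChar q a • v}
  zero_mem' := by simp
  add_mem' hv hw a c := by rw [map_add, hv, hw, smul_add]
  smul_mem' z v hv a c := by rw [map_smul, hv, smul_comm]

/-- The vectors on which the unipotent radical acts through the additive character `ψ_n`. -/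
def unipotentEigen (n : ZMod q) : Submodule ℂ V where
  carrier := {v | ∀ x, π (upper x) v = ZMod.stdAddChar (n * x) • v}
  zero_mem' := by simp
  add_mem' hv hw x := by rw [map_add, hv, hw, smul_add]
  smul_mem' z v hv x := by rw [map_smul, hv, smul_comm]

/-- The operator `ζ_e(-1) ∑ₓ π(uₓ w)`, for `uₓ` in the unipotent radical and `w` the Weyl
element. -/
def hecke : Module.End ℂ V :=
  quadChar q (-1) • ∑ x : ZMod q, π (upper x * weyl q)

/-- The eigenspace of the Hecke operator on the `(B, ζ_e)`-eigenspace. -/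
def heckeEigen (z : ℂ) : Submodule ℂ V :=
  borelEigen π ⊓ (hecke π).eigenspace z

lemma mem_heckeEigen {z : ℂ} {v : V} :
    v ∈ heckeEigen π z ↔ v ∈ borelEigen π ∧ hecke π v = z • v := by
  rw [heckeEigen, Submodule.mem_inf, Module.End.mem_eigenspace_iff]

variable {π}

lemma borelEigen_upper {v : V} (hv : v ∈ borelEigen π) (x : ZMod q) : π (upper x) v = v := by
  simpa [borelElt_one] using hv 1 x

lemma borelEigen_neg_one {v : V} (hv : v ∈ borelEigen π) :
    π (-1) v = quadChar q (-1) • v := by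
  simpa [neg_one_eq_borelElt] using hv (-1) 0

lemma hecke_apply (v : V) :
    hecke π v = quadChar q (-1) • ∑ x : ZMod q, π (upper x * weyl q) v := by
  simp [hecke, LinearMap.sum_apply]

lemma sum_affine {M : Type*} [AddCommMonoid M] (a : (ZMod q)ˣ) (c : ZMod q) (f : ZMod q → M) :
    ∑ x, f (a * x + c) = ∑ x, f x :=
  ((Units.mulLeft a).trans (Equiv.addRight c)).sum_comp f

/-- Left multiplication by an element of `B` moves `uₓ w` to another `u w` times a diagonal matrix.
It permutes the terms through the bijection `x ↦ a² x + a c`. -/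
lemma hecke_mem_borelEigen {v : V} (hv : v ∈ borelEigen π) : hecke π v ∈ borelEigen π := by
  intro a c
  rw [hecke_apply, map_smul, map_sum, smul_comm (quadChar q a)]
  congr 1
  rw [Finset.smul_sum, ← sum_affine (a * a) (a * c) fun x => quadChar q a • π (upper x * weyl q) v]
  refine Finset.sum_congr rfl fun x _ => ?_
  rw [← Module.End.mul_apply, ← map_mul, borelElt_mul_upper_mul_weyl, map_mul,
    Module.End.mul_apply, hv, map_smul, quadChar_inv, Units.val_mul, add_comm]

/-- In the double sum the term `y = 0` gives `w² = -1`, hence the scalar `q ζ_e(-1)`. For `y ≠ 0`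
the element `w u_y w` lies in `B w B`, and the term is `ζ_e(-y)` times a sum independent of `y`.
These cancel because `ζ_e` is nontrivial. -/
lemma hecke_hecke {v : V} (hv : v ∈ borelEigen π) (hq : q ≠ 2) :
    hecke π (hecke π v) = ((q : ℂ) * quadChar q (-1)) • v := by
  have key (y : ZMod q) : ∑ x, π (upper x * weyl q) (π (upper y * weyl q) v) =
      if y = 0 then ((q : ℂ) * quadChar q (-1)) • v else
        quadChar q (-y) • ∑ x, π (upper x * weyl q) v := by
    split_ifs with h
    · subst h
      have (x : ZMod q) : π (upper x * weyl q) (π (upper 0 * weyl q) v) =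
          quadChar q (-1) • v := by
        rw [← Module.End.mul_apply, ← map_mul, upper_zero, one_mul, mul_assoc, weyl_mul_weyl,
          map_mul, Module.End.mul_apply, borelEigen_neg_one hv, map_smul, borelEigen_upper hv]
      simp only [this, Finset.sum_const, Finset.card_univ, ZMod.card, ← Nat.cast_smul_eq_nsmul ℂ,
        smul_smul]
    · lift y to (ZMod q)ˣ using IsUnit.mk0 y h
      have e (x : ZMod q) : π (upper x * weyl q) (π (upper (y : ZMod q) * weyl q) v) =
          π (borelElt (-y)⁻¹ 1) (π (upper (((y * y : (ZMod q)ˣ) : ZMod q) * x + 0) * weyl q) v) := by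
        have : upper x * weyl q * (upper (y : ZMod q) * weyl q) = borelElt (-y)⁻¹ 1 *
            (upper (((y * y : (ZMod q)ˣ) : ZMod q) * x + 0) * weyl q) *
              upper (-(y : ZMod q)⁻¹) := by
          rw [mul_assoc, weyl_mul_upper_mul_weyl, ← mul_assoc, upper_mul_borelElt]
          simp [mul_assoc, -ZMod.inv_coe_unit]
        rw [← Module.End.mul_apply, ← map_mul, this, map_mul, Module.End.mul_apply,
          borelEigen_upper hv, map_mul, Module.End.mul_apply]
      rw [Finset.sum_congr rfl fun x _ => e x, ← map_sum,
        sum_affine (y * y) 0 fun x => π (upper x * weyl q) v]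
      have := hecke_mem_borelEigen hv (-y)⁻¹ 1
      rw [hecke_apply, map_smul, smul_comm (quadChar q _)] at this
      -- The factor `ζ_e(-1)²` is inserted so that the invariance of `hecke π v`, whose definition
      -- carries `ζ_e(-1)`, applies to the bare sum.
      rw [← one_smul ℂ (π _ _), ← quadChar_neg_one_sq (q := q), mul_smul, this, smul_smul,
        quadChar_neg_one_sq, one_smul, quadChar_inv, Units.val_neg]
  have e2 : ∑ y : ZMod q, ∑ x, π (upper x * weyl q) (π (upper y * weyl q) v) =
      ((q : ℂ) * quadChar q (-1)) • v := by
    rw [← Finset.add_sum_erase _ _ (Finset.mem_univ 0), key, if_pos rfl,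
      Finset.sum_congr rfl fun y hy => (key y).trans (if_neg (Finset.ne_of_mem_erase hy)),
      ← Finset.sum_smul, Finset.sum_erase _ (by simp [MulChar.map_zero]),
      show ∑ y, quadChar q (-y) = ∑ y, quadChar q y from
        Equiv.sum_comp (Equiv.neg (ZMod q)) fun y => quadChar q y,
      MulChar.sum_eq_zero_of_ne_one (quadChar_ne_one hq), zero_smul, add_zero]
  rw [hecke_apply, hecke_apply v]
  simp only [map_smul, map_sum]
  rw [← Finset.smul_sum, Finset.sum_comm, e2, smul_smul, smul_smul, ← mul_assoc,
    quadChar_neg_one_sq, one_mul]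

lemma hecke_mem_heckeEigen (hq : q ≠ 2) {z : ℂ} (hz : z ^ 2 = q * quadChar q (-1)) {v : V}
    (hv : v ∈ borelEigen π) : hecke π v + z • v ∈ heckeEigen π z := by
  refine (mem_heckeEigen π).mpr ⟨add_mem (hecke_mem_borelEigen hv) (Submodule.smul_mem _ _ hv), ?_⟩
  rw [map_add, hecke_hecke hv hq, map_smul, ← hz, smul_add, smul_smul, ← sq, add_comm]

/-! ### Dimensions of eigenspaces as traces -/

variable (π)

/-- The projection onto the `(B, ζ_e)`-eigenspace. -/
def borelProj : Module.End ℂ V :=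
  ((q : ℂ) * (q - 1))⁻¹ • ∑ a : (ZMod q)ˣ, ∑ c : ZMod q, quadChar q a • π (borelElt a c)

lemma natCast_mul_sub_one_ne_zero : ((q : ℂ) * (q - 1)) ≠ 0 := by
  have := (Fact.out : q.Prime).one_lt
  have h1 : (q : ℂ) ≠ 0 := by norm_cast; omega
  have h2 : (q : ℂ) - 1 ≠ 0 := by rw [sub_ne_zero]; norm_cast; omega
  exact mul_ne_zero h1 h2

lemma card_units_zmod : (Fintype.card (ZMod q)ˣ : ℂ) = q - 1 := by
  rw [ZMod.card_units, Nat.cast_sub (Fact.out : q.Prime).one_le, Nat.cast_one]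

lemma borelProj_apply (v : V) : borelProj π v = ((q : ℂ) * (q - 1))⁻¹ •
    ∑ a : (ZMod q)ˣ, ∑ c : ZMod q, quadChar q a • π (borelElt a c) v := by
  simp [borelProj, LinearMap.sum_apply]

lemma isProj_borelProj : LinearMap.IsProj (borelEigen π) (borelProj π) where
  map_mem v a c := by
    rw [borelProj_apply, map_smul, smul_comm (quadChar q a)]
    congr 1
    rw [map_sum, Finset.smul_sum]
    conv_rhs => rw [← Equiv.sum_comp (Equiv.mulLeft a)]
    refine Finset.sum_congr rfl fun b _ => ?_
    conv_rhs => rw [Equiv.coe_mulLeft, ← sum_affine a (c * (b : ZMod q)⁻¹)]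
    rw [map_sum, Finset.smul_sum]
    refine Finset.sum_congr rfl fun d _ => ?_
    rw [map_smul, ← Module.End.mul_apply, ← map_mul, borelElt_mul, smul_smul, Units.val_mul,
      map_mul, ← mul_assoc, quadChar_sq, one_mul]
  map_id v hv := by
    have (a : (ZMod q)ˣ) (c : ZMod q) : quadChar q a • π (borelElt a c) v = v := by
      rw [hv, smul_smul, quadChar_sq, one_smul]
    simp only [borelProj_apply, this, Finset.sum_const, Finset.card_univ, ZMod.card,
      ← Nat.cast_smul_eq_nsmul ℂ, card_units_zmod, smul_smul]
    rw [inv_mul_eq_div, mul_comm, div_self natCast_mul_sub_one_ne_zero, one_smul]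

lemma isProj_heckeEigen (hq : q ≠ 2) {z : ℂ} (hz : z ^ 2 = q * quadChar q (-1)) (hz0 : z ≠ 0) :
    LinearMap.IsProj (heckeEigen π z)
      ((2 : ℂ)⁻¹ • (borelProj π + z⁻¹ • (hecke π * borelProj π))) where
  map_mem v := by
    have := hecke_mem_heckeEigen hq hz ((isProj_borelProj π).map_mem v)
    have := Submodule.smul_mem _ ((2 : ℂ)⁻¹ * z⁻¹) this
    convert this using 1
    simp [smul_smul, hz0, add_comm]
  map_id v hv := by
    obtain ⟨h1, h2⟩ := (mem_heckeEigen π).mp hv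
    simp only [LinearMap.smul_apply, LinearMap.add_apply, Module.End.mul_apply,
      (isProj_borelProj π).map_id v h1, h2, smul_smul, inv_mul_cancel₀ hz0, one_smul, ← two_smul ℂ v]
    norm_num

/-- Conjugating `uₓ w b` by `uₓ` gives `w b uₓ`, a companion matrix. For fixed `x` the sum over the
upper right entry of `b` runs over all traces, so the sum over `x` only contributes a factor `q`. -/
lemma trace_hecke_mul_borelProj : LinearMap.trace ℂ V (hecke π * borelProj π) =
    quadChar q (-1) * ((q : ℂ) - 1)⁻¹ *
      ∑ t : ZMod q, ∑ a : (ZMod q)ˣ, quadChar q a * π.character (companion a t) := by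
  have h0 (x : ZMod q) (a : (ZMod q)ˣ) : ∑ c, LinearMap.trace ℂ V (π (upper x * weyl q) *
      π (borelElt a c)) = ∑ t, π.character (companion a t) := by
    have h1 (c : ZMod q) : LinearMap.trace ℂ V (π (upper x * weyl q) * π (borelElt a c)) =
        π.character (companion a (-(((1 : (ZMod q)ˣ) : ZMod q) * c + (a : ZMod q) * x))) := by
      rw [← map_mul, ← weyl_mul_borelElt]
      refine character_eq_of_conj π (k := upper (-x)) ?_
      rw [Units.val_one, one_mul, add_comm c, ← borelElt_mul_upper, mul_assoc, ← mul_assoc (upper _),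
        upper_mul_upper, neg_add_cancel, upper_zero, one_mul, mul_assoc, mul_assoc,
        upper_mul_upper, add_neg_cancel, upper_zero, mul_one]
    rw [Finset.sum_congr rfl fun c _ => h1 c,
      sum_affine 1 ((a : ZMod q) * x) fun c => π.character (companion a (-c)),
      ← Equiv.sum_comp (Equiv.neg (ZMod q)) fun c => π.character (companion a c)]
    rfl
  have hq0 : (q : ℂ) ≠ 0 := left_ne_zero_of_mul natCast_mul_sub_one_ne_zero
  have : LinearMap.trace ℂ V (hecke π * borelProj π) = quadChar q (-1) * ((q : ℂ) * (q - 1))⁻¹ *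
      ∑ x : ZMod q, ∑ a : (ZMod q)ˣ, quadChar q a * ∑ c, LinearMap.trace ℂ V
        (π (upper x * weyl q) * π (borelElt a c)) := by
    simp only [hecke, borelProj, smul_mul_assoc, mul_smul_comm, map_smul, smul_eq_mul,
      Finset.sum_mul, Finset.mul_sum, map_sum]
    rw [Finset.sum_congr rfl fun a _ => Finset.sum_comm, Finset.sum_comm]
    refine Finset.sum_congr rfl fun x _ => Finset.sum_congr rfl fun a _ =>
      Finset.sum_congr rfl fun c _ => ?_
    ring
  rw [this, Finset.sum_congr rfl fun x _ => Finset.sum_congr rfl fun a _ => by rw [h0 x a]]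
  simp only [Finset.mul_sum, Finset.sum_const, Finset.card_univ, ZMod.card, nsmul_eq_mul]
  rw [Finset.sum_comm]
  refine Finset.sum_congr rfl fun t _ => Finset.sum_congr rfl fun a _ => ?_
  field_simp

/-- The twisted sum of the character over the elements of trace `t` is supported on `t = ±2`. -/
lemma sum_quadChar_character_companion (hq : q ≠ 2)
    (hπ : π (-1) = quadChar q (-1) • LinearMap.id) :
    ∑ t : ZMod q, ∑ a : (ZMod q)ˣ, quadChar q a * π.character (companion a t) =
      2 * ∑ x : ZMod q, quadChar q x * π.character (upper x) := by
  have h2 : (2 : ZMod q) ≠ 0 := Ring.two_ne_zero (by rwa [ZMod.ringChar_zmod_n])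
  have hne : (2 : ZMod q) ≠ -2 := by
    intro h
    have : (2 : ZMod q) * 2 = 0 := by linear_combination h
    simp [h2] at this
  have hc (a : (ZMod q)ˣ) : π.character (companion a 2) = π.character (upper (a : ZMod q)) := by
    obtain ⟨g, hg⟩ := mul_upper_eq_companion_mul a
    exact (character_eq_of_conj π hg).symm
  have h2sum : ∑ a : (ZMod q)ˣ, quadChar q a * π.character (companion a 2) =
      ∑ x : ZMod q, quadChar q x * π.character (upper x) := by
    simp only [hc, sum_units_quadChar_mul fun x => π.character (upper x)]
  have hm2sum : ∑ a : (ZMod q)ˣ, quadChar q a * π.character (companion a (-2)) =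
      ∑ a : (ZMod q)ˣ, quadChar q a * π.character (companion a 2) := by
    rw [← Equiv.sum_comp (Equiv.neg (ZMod q)ˣ) fun a : (ZMod q)ˣ =>
      quadChar q a * π.character (companion a 2)]
    -- The central element `-1` contributes `ζ_e(-1)`, and so does the substitution `a ↦ -a`; the
    -- two signs cancel.
    refine Finset.sum_congr rfl fun a _ => ?_
    rw [companion_neg_two, Representation.character, map_mul π, hπ, Equiv.neg_apply, Units.val_neg,
      neg_eq_neg_one_mul (a : ZMod q), map_mul (quadChar q), smul_mul_assoc, map_smul, smul_eq_mul]
    change _ * (_ * π.character _) = _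
    ring
  rw [← Finset.sum_subset (Finset.subset_univ {2, -2}), Finset.sum_pair hne, h2sum, hm2sum, h2sum,
    two_mul]
  intro t _ ht
  have ht : t ^ 2 ≠ 4 := by
    intro h
    have : (t - 2) * (t - -2) = 0 := by linear_combination h
    rcases mul_eq_zero.mp this with h | h <;> simp [sub_eq_zero.mp h] at ht
  -- Away from `t = ±2` the character does not depend on `a`, so only `∑ ζ_e(a) = 0` is left.
  have (a : (ZMod q)ˣ) : π.character (companion a t) = π.character (companion 1 t) := by
    obtain ⟨g, hg⟩ := exists_mul_companion_eq hq ht a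
    exact (character_eq_of_conj π hg).symm
  simp only [this, ← Finset.sum_mul, sum_units_quadChar hq, zero_mul]

/-- The projection onto the `ψ_n`-eigenspace of the unipotent radical. -/
def unipotentProj (n : ZMod q) : Module.End ℂ V :=
  (q : ℂ)⁻¹ • ∑ x : ZMod q, ZMod.stdAddChar (-(n * x)) • π (upper x)

lemma isProj_unipotentProj (n : ZMod q) :
    LinearMap.IsProj (unipotentEigen π n) (unipotentProj π n) where
  map_mem v y := by
    simp only [unipotentProj, LinearMap.smul_apply, LinearMap.sum_apply, map_smul, map_sum]
    rw [smul_comm (ZMod.stdAddChar _)]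
    congr 1
    rw [Finset.smul_sum]
    conv_rhs => rw [← Equiv.sum_comp (Equiv.addLeft y)]
    refine Finset.sum_congr rfl fun x _ => ?_
    rw [← Module.End.mul_apply, ← map_mul, upper_mul_upper, smul_smul, ← AddChar.map_add_eq_mul,
      Equiv.coe_addLeft]
    congr 2
    ring
  map_id v hv := by
    have hq0 : (q : ℂ) ≠ 0 := left_ne_zero_of_mul natCast_mul_sub_one_ne_zero
    have (x : ZMod q) : ZMod.stdAddChar (-(n * x)) • π (upper x) v = v := by
      rw [hv, smul_smul, ← AddChar.map_add_eq_mul, neg_add_cancel, AddChar.map_zero_eq_one,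
        one_smul]
    simp only [unipotentProj, LinearMap.smul_apply, LinearMap.sum_apply, this, Finset.sum_const,
      Finset.card_univ, ZMod.card, ← Nat.cast_smul_eq_nsmul ℂ, smul_smul, inv_mul_cancel₀ hq0,
      one_smul]

variable [FiniteDimensional ℂ V]

lemma finrank_heckeEigen_eq_trace (hq : q ≠ 2) {z : ℂ} (hz : z ^ 2 = q * quadChar q (-1))
    (hz0 : z ≠ 0) : (Module.finrank ℂ (heckeEigen π z) : ℂ) =
      (Module.finrank ℂ (borelEigen π) + z⁻¹ * LinearMap.trace ℂ V (hecke π * borelProj π)) / 2 := by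
  rw [← (isProj_heckeEigen π hq hz hz0).trace, ← (isProj_borelProj π).trace]
  simp [inv_mul_eq_div, add_div]

/-- Each multiplicity is the trace of a projection, that is, a Fourier coefficient of `x ↦ tr
π(uₓ)`. Since `ζ_e` is its own Fourier transform up to the Gauss sum `g`, the identity reduces to
`g² = ζ_e(-1) q`. -/
lemma gaussSum_mul_sum_finrank_unipotentEigen (hq : q ≠ 2) :
    gaussSum (quadChar q) ZMod.stdAddChar * ∑ n : ZMod q, quadChar q n *
      (Module.finrank ℂ (unipotentEigen π n) : ℂ) =
      ∑ x : ZMod q, quadChar q x * π.character (upper x) := by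
  set g := gaussSum (quadChar q) ZMod.stdAddChar
  have hq0 : (q : ℂ) ≠ 0 := left_ne_zero_of_mul natCast_mul_sub_one_ne_zero
  have hg : g * g = quadChar q (-1) * q := by
    rw [← sq, gaussSum_sq (χ := quadChar q) (quadChar_ne_one hq) quadChar_isQuadratic (ZMod.isPrimitive_stdAddChar q),
      ZMod.card]
  have h1 (x : ZMod q) : ∑ n, quadChar q n * ZMod.stdAddChar (-(n * x)) =
      quadChar q (-1) * g * quadChar q x := by
    rcases eq_or_ne x 0 with rfl | hx
    · simpa [MulChar.map_zero] using MulChar.sum_eq_zero_of_ne_one (quadChar_ne_one hq)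
    lift x to (ZMod q)ˣ using IsUnit.mk0 x hx
    have := gaussSum_mulShift_eq (quadChar q) ZMod.stdAddChar (-x)
    rw [quadChar_isQuadratic.inv, Units.val_neg, neg_eq_neg_one_mul, map_mul] at this
    rw [mul_right_comm, ← this, gaussSum]
    simp [mul_comm]
  have h2 (n : ZMod q) : (Module.finrank ℂ (unipotentEigen π n) : ℂ) =
      (q : ℂ)⁻¹ * ∑ x, ZMod.stdAddChar (-(n * x)) * π.character (upper x) := by
    rw [← (isProj_unipotentProj π n).trace]
    simp [unipotentProj, Representation.character]
  simp only [h2, Finset.mul_sum]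
  rw [Finset.sum_comm]
  refine Finset.sum_congr rfl fun x _ => ?_
  calc _ = g * (q : ℂ)⁻¹ * π.character (upper x) *
        ∑ n, quadChar q n * ZMod.stdAddChar (-(n * x)) := by
        rw [Finset.mul_sum]; refine Finset.sum_congr rfl fun n _ => ?_; ring
    _ = (g * g) * quadChar q (-1) * (q : ℂ)⁻¹ * (quadChar q x * π.character (upper x)) := by
        rw [h1]; ring
    _ = (quadChar q (-1) * quadChar q (-1)) * (q * (q : ℂ)⁻¹) *
        (quadChar q x * π.character (upper x)) := by rw [hg]; ring
    _ = _ := by rw [quadChar_neg_one_sq, mul_inv_cancel₀ hq0, one_mul, one_mul]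

/-- The dimension of an eigenspace of the Hecke operator, through the multiplicities of the
additive characters of the unipotent radical. -/
theorem finrank_heckeEigen (hq : q ≠ 2) (hπ : π (-1) = quadChar q (-1) • LinearMap.id)
    {z : ℂ} (hz : z ^ 2 = q * quadChar q (-1)) (hz0 : z ≠ 0) :
    (Module.finrank ℂ (heckeEigen π z) : ℂ) = 1 / 2 * (Module.finrank ℂ (borelEigen π) : ℂ) +
      gaussSum (quadChar q) ZMod.stdAddChar / z * (quadChar q (-1) / ((q : ℂ) - 1) *
        ∑ n : (ZMod q)ˣ, quadChar q n * (Module.finrank ℂ (unipotentEigen π (n : ZMod q)) : ℂ)) := by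
  rw [finrank_heckeEigen_eq_trace π hq hz hz0, trace_hecke_mul_borelProj,
    sum_quadChar_character_companion π hq hπ, ← gaussSum_mul_sum_finrank_unipotentEigen π hq,
    sum_units_quadChar_mul fun n => (Module.finrank ℂ (unipotentEigen π n) : ℂ)]
  ring

end Hecke

/-! ### The sign of the quadratic Gauss sum -/

section GaussSign

open Polynomial

/-! ### The operator `X d/dX` and vanishing orders at `1` -/

section EulerOperator

variable (R : Type*) [CommRing R]

/-- The Euler operator `X d/dX` on polynomials. -/
def eulerOp : Module.End R R[X] := LinearMap.mulLeft R X ∘ₗ derivative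

variable {R}

lemma eulerOp_apply (f : R[X]) : eulerOp R f = X * derivative f := rfl

lemma eulerOp_pow_X_pow (n j : ℕ) : (eulerOp R ^ n) (X ^ j) = C ((j : R) ^ n) * X ^ j := by
  induction n with
  | zero => simp
  | succ n ih =>
    rw [pow_succ', Module.End.mul_apply, ih, eulerOp_apply, derivative_C_mul, derivative_X_pow]
    rcases j with _ | j
    · simp
    · simp only [Nat.add_sub_cancel, pow_succ, map_mul]
      ring

/-- Each application of `X d/dX` lowers the order of vanishing at `1` by at most one. After `n`
steps only an exact factor `(X - 1)^n` survives, with weight `n!`. -/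
lemma eval_eulerOp_pow (n r : ℕ) (g : R[X]) :
    eval 1 ((eulerOp R ^ n) ((X - 1) ^ (n + r) * g)) =
      if r = 0 then (n.factorial : R) * eval 1 g else 0 := by
  induction n generalizing g with
  | zero => rcases r with _ | r <;> simp
  | succ n ih =>
    rw [pow_succ, Module.End.mul_apply, eulerOp_apply]
    have : X * derivative ((X - 1 : R[X]) ^ (n + 1 + r) * g) = (X - 1) ^ (n + r) *
        (((n + 1 + r : ℕ) : R[X]) * X * g + (X - 1) * (X * derivative g)) := by
      rw [show n + 1 + r = n + r + 1 by ring, derivative_mul, ← C_1, derivative_X_sub_C_pow]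
      push_cast
      simp
      ring
    rw [this, ih]
    split_ifs with h
    · subst h
      simp [Nat.factorial_succ]
      ring
    · rfl

end EulerOperator

variable {q : ℕ} [Fact q.Prime]

/-! ### The Gauss sum and the half system product modulo `q` -/

lemma two_mul_half_add_one (hq : q ≠ 2) : 2 * (q / 2) + 1 = q := by
  have := (Fact.out : q.Prime).eq_two_or_odd
  omega

lemma intCast_sign_injective (hq : q ≠ 2) {x y : ℤ} (hx : x = 1 ∨ x = -1) (hy : y = 1 ∨ y = -1)
    (h : (x : ZMod q) = y) : x = y := by
  have h2 : (2 : ZMod q) ≠ 0 := Ring.two_ne_zero (by rwa [ZMod.ringChar_zmod_n])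
  rcases hx with rfl | rfl <;> rcases hy with rfl | rfl <;> first | rfl | exfalso
  · push_cast at h
    exact h2 (by linear_combination h)
  · push_cast at h
    exact h2 (by linear_combination -h)

lemma quadraticChar_neg_one_eq (hq : q ≠ 2) :
    quadraticChar (ZMod q) (-1) = (-1) ^ (q / 2) := by
  refine intCast_sign_injective hq (quadraticChar_dichotomy (by simp))
    (neg_one_pow_eq_or ℤ _) ?_
  have := quadraticChar_eq_pow_of_char_ne_two' (F := ZMod q) (by rwa [ZMod.ringChar_zmod_n]) (-1)
  rw [this, ZMod.card]
  push_cast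
  rfl

/-- By Euler's criterion the character is `a ^ ((q - 1) / 2)`, so each nonzero `a` contributes `a ^
(q - 1) = 1` and the sum is `q - 1`. -/
lemma sum_quadraticChar_mul_pow (hq : q ≠ 2) :
    ∑ a : ZMod q, (quadraticChar (ZMod q) a : ZMod q) * a ^ (q / 2) = -1 := by
  have h (a : ZMod q) : (quadraticChar (ZMod q) a : ZMod q) * a ^ (q / 2) =
      if a = 0 then 0 else 1 := by
    rw [quadraticChar_eq_pow_of_char_ne_two' (by rwa [ZMod.ringChar_zmod_n]), ZMod.card, ← pow_add,
      show q / 2 + q / 2 = q - 1 by have := two_mul_half_add_one hq; omega]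
    split_ifs with h
    · rw [h, zero_pow]
      have := (Fact.out : q.Prime).two_le
      omega
    · exact ZMod.pow_card_sub_one_eq_one h
  simp only [h]
  rw [Finset.sum_ite, Finset.sum_const_zero, zero_add, Finset.sum_const, Finset.filter_ne',
    Finset.card_erase_of_mem (Finset.mem_univ _), Finset.card_univ, ZMod.card, nsmul_eq_mul,
    Nat.cast_sub (Fact.out : q.Prime).one_le]
  simp

/-- In Wilson's theorem the upper half of the factors of `(q - 1)!`, read backwards, is the lower
half up to the sign `(-1)^m`. -/
lemma factorial_half_sq (hq : q ≠ 2) :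
    ((q / 2).factorial : ZMod q) * ((q / 2).factorial : ZMod q) = -(-1) ^ (q / 2) := by
  set m := q / 2 with hm
  have hmq : 2 * m + 1 = q := two_mul_half_add_one hq
  have hq0 : (2 * m + 1 : ZMod q) = 0 := by
    have : ((2 * m + 1 : ℕ) : ZMod q) = (q : ℕ) := congrArg _ hmq
    rw [ZMod.natCast_self] at this
    exact_mod_cast this
  have h := ZMod.wilsons_lemma q
  rw [show q - 1 = m + m by omega, ← Finset.prod_range_add_one_eq_factorial, Finset.prod_range_add,
    ← Finset.prod_range_reflect (fun x => m + x + 1)] at h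
  push_cast at h
  have h2 : ∏ x ∈ Finset.range m, ((m : ZMod q) + ((m - 1 - x : ℕ) : ZMod q) + 1) =
      (-1) ^ m * ∏ x ∈ Finset.range m, ((x : ZMod q) + 1) := by
    rw [← Finset.card_range m, ← Finset.prod_const, Finset.card_range, ← Finset.prod_mul_distrib]
    refine Finset.prod_congr rfl fun x hx => ?_
    have : x + 1 ≤ m := Finset.mem_range.mp hx
    rw [show m - 1 - x = m - (x + 1) by omega, Nat.cast_sub this]
    push_cast
    linear_combination hq0
  rw [h2] at h
  rw [← Finset.prod_range_add_one_eq_factorial]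
  push_cast
  have h3 : ((-1 : ZMod q) ^ m) * (-1) ^ m = 1 := by rw [← mul_pow]; simp
  linear_combination (-1 : ZMod q) ^ m * h -
    (∏ x ∈ Finset.range m, ((x : ZMod q) + 1)) * (∏ x ∈ Finset.range m, ((x : ZMod q) + 1)) * h3

/-- If the quadratic Gauss sum is an integral multiple of a half system product, the multiple
is determined modulo `q`. -/
lemma gaussSum_multiple_mod (hq : q ≠ 2) {ζ : ℂ} (hζ : IsPrimitiveRoot ζ q) (e : ℤ)
    (h : ∑ a : ZMod q, (quadraticChar (ZMod q) a : ℂ) * ζ ^ a.val =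
      e * ∏ k ∈ Finset.range (q / 2), (ζ ^ ((k + 1) * (q / 2 + 1)) - ζ ^ ((k + 1) * (q / 2)))) :
    (e : ZMod q) = (-1) ^ (q / 2) := by
  set m := q / 2 with hm
  have hmq : 2 * m + 1 = q := two_mul_half_add_one hq
  have hm0 : m ≠ 0 := by
    have := (Fact.out : q.Prime).two_le
    omega
  -- `F` vanishes at `ζ`, so the cyclotomic polynomial divides it. Modulo `q` that polynomial is `(X
  -- - 1)^(2m)`, so `(X d/dX)^m F` vanishes at `1`. There the Gauss sum part gives `∑ ζ_e(a) a^m =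
  -- -1` and the product part gives `e (m!)²`.
  let F : ℤ[X] := ∑ a : ZMod q, C (quadraticChar (ZMod q) a) * X ^ a.val -
    C e * ∏ k ∈ Finset.range m, (X ^ ((k + 1) * (m + 1)) - X ^ ((k + 1) * m))
  have hF : aeval ζ F = 0 := by
    simp only [F, map_sub, map_sum, map_mul, map_prod, aeval_C, map_pow, aeval_X,
      algebraMap_int_eq, Int.coe_castRingHom, h, sub_self]
  have hdvd : cyclotomic q ℤ ∣ F := by
    rw [cyclotomic_eq_minpoly hζ (Fact.out : q.Prime).pos]
    exact minpoly.isIntegrallyClosed_dvd (hζ.isIntegral (Fact.out : q.Prime).pos) hF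
  obtain ⟨g, hg⟩ : (X - 1 : (ZMod q)[X]) ^ (m + m) ∣ F.map (Int.castRingHom (ZMod q)) := by
    have := Polynomial.map_dvd (Int.castRingHom (ZMod q)) hdvd
    rw [map_cyclotomic] at this
    have hc := cyclotomic_mul_prime_eq_pow_of_not_dvd (ZMod q) (p := q) (n := 1)
      (by simpa using (Fact.out : q.Prime).ne_one)
    rw [one_mul, cyclotomic_one] at hc
    rwa [hc, show q - 1 = m + m by omega] at this
  have h0 := eval_eulerOp_pow m m g
  rw [← hg, if_neg hm0] at h0
  have hprod : ∏ k ∈ Finset.range m, ((X : (ZMod q)[X]) ^ ((k + 1) * (m + 1)) - X ^ ((k + 1) * m)) =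
      (X - 1) ^ (m + 0) * ∏ k ∈ Finset.range m,
        (X ^ ((k + 1) * m) * ∑ i ∈ Finset.range (k + 1), X ^ i) := by
    rw [add_zero]
    conv_rhs => rw [← Finset.card_range m, ← Finset.prod_const, Finset.card_range,
      ← Finset.prod_mul_distrib]
    refine Finset.prod_congr rfl fun k _ => ?_
    rw [mul_left_comm, mul_geom_sum, mul_sub, ← pow_add, mul_one]
    rfl
  have hmap : F.map (Int.castRingHom (ZMod q)) =
      ∑ a : ZMod q, (quadraticChar (ZMod q) a : ZMod q) • X ^ a.val -
      (e : ZMod q) • ((X - 1) ^ (m + 0) * ∏ k ∈ Finset.range m,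
        (X ^ ((k + 1) * m) * ∑ i ∈ Finset.range (k + 1), X ^ i)) := by
    rw [← hprod]
    simp [F, Polynomial.map_sum, Polynomial.map_prod, smul_eq_C_mul]
  have hev : eval 1 (∏ k ∈ Finset.range m,
      ((X : (ZMod q)[X]) ^ ((k + 1) * m) * ∑ i ∈ Finset.range (k + 1), X ^ i)) =
      (m.factorial : ZMod q) := by
    rw [← Finset.prod_range_add_one_eq_factorial, eval_prod, Nat.cast_prod]
    simp [eval_finsetSum]
  rw [hmap, map_sub, map_sum, eval_sub, eval_finsetSum, map_smul, eval_smul, eval_eulerOp_pow,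
    if_pos rfl, hev, factorial_half_sq hq,
    Finset.sum_congr rfl (g := fun a : ZMod q => (quadraticChar (ZMod q) a : ZMod q) * a ^ m),
    sum_quadraticChar_mul_pow hq, smul_eq_mul] at h0
  · have h3 : ((-1 : ZMod q) ^ m) * (-1) ^ m = 1 := by rw [← mul_pow]; simp
    linear_combination (-1 : ZMod q) ^ m * h0 - (e : ZMod q) * h3
  · intro a _
    rw [map_smul, eval_smul, eulerOp_pow_X_pow]
    simp

/-- As `m + 1` and `m` are `1/2` and `-1/2` modulo `q`, the factors are `ζ^(j/2) - ζ^(-j/2)` for `1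
≤ j ≤ m`. Their squares are `-(1 - ζ^j)(1 - ζ^(-j))`, and the product of `1 - ζ^j` over all nonzero
residues is `q`. -/
lemma halfSystem_prod_sq (hq : q ≠ 2) {ζ : ℂ} (hζ : IsPrimitiveRoot ζ q) :
    (∏ k ∈ Finset.range (q / 2), (ζ ^ ((k + 1) * (q / 2 + 1)) - ζ ^ ((k + 1) * (q / 2)))) ^ 2 =
      (-1) ^ (q / 2) * q := by
  set m := q / 2 with hm
  have hmq : 2 * m + 1 = q := two_mul_half_add_one hq
  have hq1 : ζ ^ (2 * m + 1) = 1 := by rw [hmq, hζ.pow_eq_one]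
  have h := IsPrimitiveRoot.prod_one_sub_pow_eq_order (n := m + m) (μ := ζ)
    (by rwa [← two_mul, hmq])
  rw [Finset.prod_range_add, ← Finset.prod_range_reflect (fun x => 1 - ζ ^ (m + x + 1)),
    ← Finset.prod_mul_distrib] at h
  rw [← hmq, ← Finset.prod_pow]
  conv_rhs => rw [← Finset.card_range m, ← Finset.prod_const, Finset.card_range]
  push_cast at h ⊢
  rw [two_mul, ← h, ← Finset.prod_mul_distrib]
  refine Finset.prod_congr rfl fun k hk => ?_
  have hk : k + 1 ≤ m := Finset.mem_range.mp hk
  have e1 : ζ ^ (m + (m - 1 - k) + 1) * ζ ^ (k + 1) = 1 := by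
    rw [← pow_add, show m + (m - 1 - k) + 1 + (k + 1) = 2 * m + 1 by omega, hq1]
  have e2 : ζ ^ ((k + 1) * (m + 1)) * ζ ^ ((k + 1) * m) = 1 := by
    rw [← pow_add, show (k + 1) * (m + 1) + (k + 1) * m = (2 * m + 1) * (k + 1) by ring, pow_mul, hq1,
      one_pow]
  have e3 : (ζ ^ ((k + 1) * (m + 1))) ^ 2 = ζ ^ (k + 1) := by
    rw [← pow_mul, show (k + 1) * (m + 1) * 2 = (2 * m + 1) * (k + 1) + (k + 1) by ring, pow_add,
      pow_mul, hq1, one_pow, one_mul]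
  generalize ζ ^ ((k + 1) * (m + 1)) = A at *
  generalize ζ ^ ((k + 1) * m) = B at *
  generalize ζ ^ (m + (m - 1 - k) + 1) = w at *
  generalize ζ ^ (k + 1) = z at *
  have e4 : B ^ 2 = w := by
    linear_combination (w * A * B + w) * e2 - B ^ 2 * e1 - w * B ^ 2 * e3
  linear_combination e3 + e4 - 2 * e2 + e1

/-! ### The half system product at `exp(2πi/q)` -/

lemma prod_neg_one_pow_mul_I (m : ℕ) :
    ∏ k ∈ Finset.range m, ((-1) ^ k * Complex.I) = if Even m then 1 else Complex.I := by
  induction m with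
  | zero => simp
  | succ m ih =>
    rw [Finset.prod_range_succ, ih]
    by_cases h : Even m
    · simp [h, Nat.even_add_one, h.neg_one_pow]
    · simp [h, Nat.even_add_one, (Nat.not_even_iff_odd.mp h).neg_one_pow]

/-- With `j = k + 1` the factors are `(-1)^j · 2i sin(πj/q)`, and all these sines are positive.
Distributing `(-1)^(q/2)` over the factors leaves the phases `(-1)^k i`. -/
lemma halfSystem_prod_eq (hq : q ≠ 2) :
    ∃ r : ℝ, 0 < r ∧ (-1) ^ (q / 2) * ∏ k ∈ Finset.range (q / 2),
      (Complex.exp (2 * Real.pi * Complex.I / q) ^ ((k + 1) * (q / 2 + 1)) -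
        Complex.exp (2 * Real.pi * Complex.I / q) ^ ((k + 1) * (q / 2))) =
      (if Even (q / 2) then 1 else Complex.I) * r := by
  set m := q / 2 with hm
  have hmq : 2 * m + 1 = q := two_mul_half_add_one hq
  have hqpos : (0 : ℝ) < q := by exact_mod_cast (Fact.out : q.Prime).pos
  refine ⟨∏ k ∈ Finset.range m, (2 * Real.sin (Real.pi * (k + 1) / q)), ?_, ?_⟩
  · refine Finset.prod_pos fun k hk => mul_pos two_pos (Real.sin_pos_of_pos_of_lt_pi ?_ ?_)
    · have := Real.pi_pos
      positivity
    · rw [div_lt_iff₀ hqpos]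
      refine mul_lt_mul_of_pos_left ?_ Real.pi_pos
      have : k + 1 < q := by have := Finset.mem_range.mp hk; omega
      exact_mod_cast this
  · rw [← prod_neg_one_pow_mul_I, Complex.ofReal_prod, ← Finset.prod_mul_distrib]
    conv_lhs => rw [← Finset.card_range m, ← Finset.prod_const, Finset.card_range,
      ← Finset.prod_mul_distrib]
    refine Finset.prod_congr rfl fun k _ => ?_
    have hq0 : (q : ℂ) ≠ 0 := by exact_mod_cast hqpos.ne'
    have hmC : (q : ℂ) = 2 * m + 1 := by
      have : ((2 * m + 1 : ℕ) : ℂ) = q := by rw [hmq]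
      rw [← this]
      push_cast
      rfl
    have e1 : Complex.exp (2 * Real.pi * Complex.I / q) ^ ((k + 1) * (m + 1)) =
        (-1) ^ (k + 1) * Complex.exp ((Real.pi * (k + 1) / q) * Complex.I) := by
      rw [← Complex.exp_pi_mul_I, ← Complex.exp_nat_mul, ← Complex.exp_nat_mul, ← Complex.exp_add]
      congr 1
      push_cast
      field_simp
      rw [hmC]
      ring
    have e2 : Complex.exp (2 * Real.pi * Complex.I / q) ^ ((k + 1) * m) =
        (-1) ^ (k + 1) * Complex.exp (-(Real.pi * (k + 1) / q) * Complex.I) := by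
      rw [← Complex.exp_pi_mul_I, ← Complex.exp_nat_mul, ← Complex.exp_nat_mul, ← Complex.exp_add]
      congr 1
      push_cast
      field_simp
      rw [hmC]
      ring
    have e3 := Complex.two_sin (Real.pi * (k + 1) / q)
    rw [e1, e2]
    push_cast
    rw [e3, pow_succ]
    generalize Complex.exp (-(Real.pi * (k + 1) / q) * Complex.I) = A
    generalize Complex.exp ((Real.pi * (k + 1) / q) * Complex.I) = B
    linear_combination -(-1 : ℂ) ^ k * (A - B) * Complex.I_mul_I

lemma gaussSum_quadChar_eq_sum : gaussSum (quadChar q) ZMod.stdAddChar =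
    ∑ a : ZMod q, (quadraticChar (ZMod q) a : ℂ) *
      Complex.exp (2 * Real.pi * Complex.I / q) ^ a.val := by
  refine Finset.sum_congr rfl fun a _ => ?_
  congr 1
  conv_lhs => rw [← ZMod.natCast_zmod_val a, ← Int.cast_natCast, ZMod.stdAddChar_coe]
  rw [← Complex.exp_nat_mul]
  congr 1
  push_cast
  ring

/-- Gauss's determination of the sign of the quadratic Gauss sum. -/
theorem gaussSum_quadChar (hq : q ≠ 2) :
    gaussSum (quadChar q) ZMod.stdAddChar = sqrtQEps q := by
  set g := gaussSum (quadChar q) ZMod.stdAddChar with hg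
  have hg2 : g ^ 2 = q * quadChar q (-1) := by
    rw [hg, gaussSum_sq (χ := quadChar q) (quadChar_ne_one hq) quadChar_isQuadratic
      (ZMod.isPrimitive_stdAddChar q), ZMod.card, mul_comm]
  have hε : quadChar q (-1) = (-1) ^ (q / 2) := by
    rw [quadChar, MulChar.ringHomComp_apply, quadraticChar_neg_one_eq hq]
    simp
  have hζ := Complex.isPrimitiveRoot_exp q (Fact.out : q.Prime).ne_zero
  have hQ2 := halfSystem_prod_sq hq hζ
  obtain ⟨r, hr, hQ⟩ := halfSystem_prod_eq hq
  have hmult := gaussSum_multiple_mod hq hζ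
  rw [← gaussSum_quadChar_eq_sum, ← hg] at hmult
  set Q := ∏ k ∈ Finset.range (q / 2),
      (Complex.exp (2 * Real.pi * Complex.I / q) ^ ((k + 1) * (q / 2 + 1)) -
        Complex.exp (2 * Real.pi * Complex.I / q) ^ ((k + 1) * (q / 2)))
  have hgQ : g = (-1) ^ (q / 2) * Q := by
    -- Equal squares give `g = ±Q`, and the congruence modulo `q` then selects the sign.
    obtain ⟨e, he, hge⟩ : ∃ e : ℤ, (e = 1 ∨ e = -1) ∧ g = e * Q := by
      rcases sq_eq_sq_iff_eq_or_eq_neg.mp (hg2.trans (by rw [hQ2, hε, mul_comm])) with h | h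
      · exact ⟨1, Or.inl rfl, by simpa using h⟩
      · exact ⟨-1, Or.inr rfl, by simpa using h⟩
    have := intCast_sign_injective hq he (neg_one_pow_eq_or ℤ (q / 2))
      (by rw [hmult e hge]; push_cast; rfl)
    rw [hge, this]
    push_cast
    rfl
  -- `g` is a positive multiple of `1` or of `i`, so its argument lies in `(-π/2, π/2]`, where the
  -- principal square root of `g²` is `g`.
  have harg : -(Real.pi / (2 : ℕ)) < g.arg ∧ g.arg ≤ Real.pi / (2 : ℕ) := by
    have := Real.pi_pos
    rw [hgQ, hQ, mul_comm, Complex.arg_real_mul _ hr]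
    push_cast
    split_ifs
    · rw [Complex.arg_one]
      constructor <;> linarith
    · rw [Complex.arg_I]
      constructor <;> linarith
  have := Complex.pow_cpow_nat_inv two_ne_zero harg.1 harg.2
  rw [sqrtQEps, ← hg2, one_div]
  exact_mod_cast this.symm

end GaussSign

/-! ### Irreducibility of subrepresentations -/

section Irreducible

variable {G V : Type*} [Group G] [AddCommGroup V] [Module ℂ V] {ρ : Representation ℂ G V}

/-- A subrepresentation contained in another one, as a subrepresentation of the latter. -/
def subrepComap (W S : Subrepresentation ρ) : Subrepresentation W.toRepresentation where
  toSubmodule := S.toSubmodule.comap W.toSubmodule.subtype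
  apply_mem_toSubmodule g _ hv := S.apply_mem_toSubmodule g hv

/-- A subrepresentation of a subrepresentation, as a subrepresentation of the ambient one. -/
def subrepMap (W : Subrepresentation ρ) (S : Subrepresentation W.toRepresentation) :
    Subrepresentation ρ where
  toSubmodule := S.toSubmodule.map W.toSubmodule.subtype
  apply_mem_toSubmodule g := by
    rintro _ ⟨v, hv, rfl⟩
    exact ⟨W.toRepresentation g v, S.apply_mem_toSubmodule g hv, rfl⟩

lemma isIrreducible_toRepresentation_iff (W : Subrepresentation ρ) :
    W.toRepresentation.IsIrreducible ↔ W.toSubmodule ≠ ⊥ ∧ ∀ S : Subrepresentation ρ,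
      S.toSubmodule ≤ W.toSubmodule → S.toSubmodule ≠ ⊥ → S.toSubmodule = W.toSubmodule := by
  have hbot : (⊥ : Subrepresentation W.toRepresentation).toSubmodule = ⊥ := rfl
  have htop : (⊤ : Subrepresentation W.toRepresentation).toSubmodule = ⊤ := rfl
  constructor
  · intro h
    constructor
    · intro hW
      apply bot_ne_top (α := Subrepresentation W.toRepresentation)
      apply Subrepresentation.toSubmodule_injective
      rw [hbot, htop]
      ext v
      have : (v : V) ∈ (⊥ : Submodule ℂ V) := hW ▸ v.2
      simpa using this
    · intro S hS hS0
      rcases h.eq_bot_or_eq_top (subrepComap W S) with h | h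
      · have h := congrArg Subrepresentation.toSubmodule h
        rw [hbot] at h
        exact absurd ((Submodule.disjoint_iff_comap_eq_bot.mpr h).eq_bot_of_ge hS) hS0
      · have h := congrArg Subrepresentation.toSubmodule h
        rw [htop] at h
        exact le_antisymm hS (Submodule.comap_subtype_eq_top.mp h)
  · rintro ⟨h0, h⟩
    refine { exists_pair_ne := ⟨⊥, ⊤, fun e => h0 ?_⟩, eq_bot_or_eq_top := fun S => ?_ }
    · have e := congrArg Subrepresentation.toSubmodule e
      rw [hbot, htop] at e
      rw [← Submodule.map_subtype_top W.toSubmodule, ← e, Submodule.map_bot]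
    · by_cases hS : S.toSubmodule = ⊥
      · exact Or.inl (Subrepresentation.toSubmodule_injective hS)
      · right
        apply Subrepresentation.toSubmodule_injective
        have := h (subrepMap W S) (Submodule.map_subtype_le _ _)
          (fun e => hS (Submodule.map_injective_of_injective W.toSubmodule.subtype_injective
            (e.trans (Submodule.map_bot _).symm)))
        rw [htop]
        apply Submodule.map_injective_of_injective W.toSubmodule.subtype_injective
        rw [Submodule.map_subtype_top]
        exact this

end Irreducible

/-! ### The principal series of the quadratic character -/

section PrincipalSeries

variable {q : ℕ} [Fact q.Prime]

variable (q) in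
/-- The space of `ρ(ζ_e)`. -/
abbrev QuadSeries : Type := PrincipalSeriesSpace q (quadChar q)

variable (q) in
/-- The principal series `ρ(ζ_e)`. -/
abbrev quadSeries : Representation ℂ SL(2, ZMod q) (QuadSeries q) :=
  principalSeries q (quadChar q)

variable (q) in
/-- The vectors of `ρ(ζ_e)` as functions on `SL₂(𝔽_q)`. -/
def seriesFun : QuadSeries q →ₗ[ℂ] (SL(2, ZMod q) → ℂ) :=
  (Representation.coindV (borel q).subtype (borelChar q (quadChar q))).subtype

lemma seriesFun_injective : Function.Injective (seriesFun q) := Subtype.val_injective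

lemma seriesFun_apply_act (g x : SL(2, ZMod q)) (φ : QuadSeries q) :
    seriesFun q (quadSeries q g φ) x = seriesFun q φ (x * g) := rfl

lemma seriesFun_mul (φ : QuadSeries q) {b : SL(2, ZMod q)} (hb : b 1 0 = 0) (x : SL(2, ZMod q)) :
    seriesFun q φ (b * x) = quadChar q (b 0 0) * seriesFun q φ x :=
  φ.2 ⟨b, hb⟩ x

lemma seriesFun_borelElt_mul (φ : QuadSeries q) (a : (ZMod q)ˣ) (c : ZMod q)
    (x : SL(2, ZMod q)) :
    seriesFun q φ (borelElt a c * x) = quadChar q a * seriesFun q φ x :=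
  seriesFun_mul φ rfl x

lemma eq_borelElt {b : SL(2, ZMod q)} (hb : b 1 0 = 0) : ∃ a c, b = borelElt a c := by
  have hdet := b.det_coe
  rw [Matrix.det_fin_two, hb, mul_zero, sub_zero] at hdet
  refine ⟨Units.mkOfMulEqOne _ _ hdet, b 0 1, SL2_ext rfl rfl hb ?_⟩
  rw [borelElt_11]
  exact eq_inv_of_mul_eq_one_right hdet

variable (q) in
/-- The left regular representation on functions. -/
def leftReg : Representation ℂ SL(2, ZMod q) (SL(2, ZMod q) → ℂ) where
  toFun g := LinearMap.funLeft ℂ ℂ (g⁻¹ * ·)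
  map_one' := by ext; simp
  map_mul' g h := by ext; simp [mul_assoc, LinearMap.funLeft]

lemma leftReg_apply (g x : SL(2, ZMod q)) (φ : SL(2, ZMod q) → ℂ) :
    leftReg q g φ x = φ (g⁻¹ * x) := rfl

lemma borelElt_inv (a : (ZMod q)ˣ) (c : ZMod q) : (borelElt a c)⁻¹ = borelElt a⁻¹ (-c) := by
  rw [inv_eq_iff_mul_eq_one, borelElt_mul, mul_inv_cancel]
  apply SL2_ext <;> simp [-ZMod.inv_coe_unit, mul_comm]

/-- The inverse in the left regular action is harmless because `ζ_e` is quadratic. Hence `ρ(ζ_e)` is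
the space of `(B, ζ_e)`-vectors of the left regular representation, and the facts about `hecke`
apply to it. -/
lemma mem_borelEigen_leftReg {φ : SL(2, ZMod q) → ℂ} : φ ∈ borelEigen (leftReg q) ↔
    ∀ a c x, φ (borelElt a c * x) = quadChar q a * φ x := by
  constructor
  · intro h a c x
    have := congrFun (h a⁻¹ (-c)) x
    rw [leftReg_apply, borelElt_inv, inv_inv, neg_neg, quadChar_inv] at this
    exact this
  · intro h a c
    ext x
    rw [leftReg_apply, borelElt_inv, h, quadChar_inv]
    rfl

/-- A function on `SL₂(𝔽_q)` with the transformation law of `ρ(ζ_e)`, as a vector. -/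
def seriesMk (φ : SL(2, ZMod q) → ℂ) (h : φ ∈ borelEigen (leftReg q)) : QuadSeries q :=
  ⟨φ, fun b x => by
    obtain ⟨a, c, hb⟩ := eq_borelElt b.2
    change φ (b.1 * x) = quadChar q (b.1 0 0) * φ x
    rw [hb]
    exact mem_borelEigen_leftReg.mp h a c x⟩

@[simp] lemma seriesFun_mk (φ : SL(2, ZMod q) → ℂ) (h : φ ∈ borelEigen (leftReg q)) :
    seriesFun q (seriesMk φ h) = φ := rfl

lemma seriesFun_mem (φ : QuadSeries q) : seriesFun q φ ∈ borelEigen (leftReg q) :=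
  mem_borelEigen_leftReg.mpr (seriesFun_borelElt_mul φ)

variable (q) in
/-- The intertwining operator on `ρ(ζ_e)`. -/
def seriesHecke : Module.End ℂ (QuadSeries q) where
  toFun φ := seriesMk (hecke (leftReg q) (seriesFun q φ))
    (hecke_mem_borelEigen (seriesFun_mem φ))
  map_add' _ _ := seriesFun_injective (by simp)
  map_smul' _ _ := seriesFun_injective (by simp)

lemma seriesFun_hecke (φ : QuadSeries q) :
    seriesFun q (seriesHecke q φ) = hecke (leftReg q) (seriesFun q φ) := rfl

lemma seriesFun_hecke_apply (φ : QuadSeries q) (x : SL(2, ZMod q)) :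
    seriesFun q (seriesHecke q φ) x =
      quadChar q (-1) * ∑ y : ZMod q, seriesFun q φ ((upper y * weyl q)⁻¹ * x) := by
  rw [seriesFun_hecke, hecke_apply]
  simp only [Pi.smul_apply, Finset.sum_apply, leftReg_apply, smul_eq_mul]

lemma seriesHecke_seriesHecke (hq : q ≠ 2) (φ : QuadSeries q) :
    seriesHecke q (seriesHecke q φ) = ((q : ℂ) * quadChar q (-1)) • φ :=
  seriesFun_injective (hecke_hecke (seriesFun_mem φ) hq)

/-- Left translations commute with right translations. -/
lemma seriesHecke_comm (g : SL(2, ZMod q)) (φ : QuadSeries q) :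
    seriesHecke q (quadSeries q g φ) = quadSeries q g (seriesHecke q φ) := by
  apply seriesFun_injective
  ext x
  simp only [seriesFun_hecke_apply, seriesFun_apply_act, mul_assoc]

variable (q) in
/-- The eigenspace of the intertwining operator. -/
def seriesEigen (z : ℂ) : Subrepresentation (quadSeries q) where
  toSubmodule := (seriesHecke q).eigenspace z
  apply_mem_toSubmodule g φ hφ := by
    rw [Module.End.mem_eigenspace_iff] at hφ ⊢
    rw [seriesHecke_comm, hφ, map_smul]

lemma mem_seriesEigen {z : ℂ} {φ : QuadSeries q} :
    φ ∈ (seriesEigen q z).toSubmodule ↔ seriesHecke q φ = z • φ :=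
  Module.End.mem_eigenspace_iff

/-- The function on `SL₂(𝔽_q)` with the transformation law of `ρ(ζ_e)` and given values at
representatives of the cosets of the Borel subgroup. -/
def seriesExtend (v : Option (ZMod q) → ℂ) (g : SL(2, ZMod q)) : ℂ :=
  if g 1 0 = 0 then quadChar q (g 1 1) * v none
  else quadChar q (-1) * quadChar q (g 1 0) * v (some (g 1 1 / g 1 0))

lemma seriesExtend_borelElt_mul (v : Option (ZMod q) → ℂ) (a : (ZMod q)ˣ) (c : ZMod q)
    (x : SL(2, ZMod q)) :
    seriesExtend v (borelElt a c * x) = quadChar q a * seriesExtend v x := by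
  have ha := a.ne_zero
  have h10 : (borelElt a c * x) 1 0 = (a⁻¹ : (ZMod q)ˣ) * x 1 0 := by
    simp [SL2_mul_apply, -ZMod.inv_coe_unit]
  have h11 : (borelElt a c * x) 1 1 = (a⁻¹ : (ZMod q)ˣ) * x 1 1 := by
    simp [SL2_mul_apply, -ZMod.inv_coe_unit]
  rw [seriesExtend, seriesExtend, h10, h11]
  simp only [mul_eq_zero, Units.ne_zero, false_or, map_mul, quadChar_inv,
    mul_div_mul_left _ _ (Units.ne_zero a⁻¹)]
  split_ifs <;> ring

/-- A vector of `ρ(ζ_e)` is determined by its values at representatives of the cosets of the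
Borel subgroup. -/
def seriesEquiv : QuadSeries q ≃ₗ[ℂ] (Option (ZMod q) → ℂ) where
  toFun φ i := i.elim (seriesFun q φ 1) fun x => seriesFun q φ (weyl q * upper x)
  map_add' φ ψ := by ext i; rcases i with _ | x <;> simp
  map_smul' z φ := by ext i; rcases i with _ | x <;> simp
  invFun v := seriesMk (seriesExtend v)
    (mem_borelEigen_leftReg.mpr (seriesExtend_borelElt_mul v))
  left_inv φ := by
    apply seriesFun_injective
    ext g
    rw [seriesFun_mk, seriesExtend]
    split_ifs with h
    · have hd := g.det_coe
      rw [Matrix.det_fin_two, h, mul_zero, sub_zero] at hd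
      have := seriesFun_mul φ h 1
      rw [mul_one] at this
      rw [this]
      have e : quadChar q (g 0 0) * quadChar q (g 1 1) = 1 := by rw [← map_mul, hd, map_one]
      have h1 : quadChar q (g 1 1) * quadChar q (g 1 1) = 1 :=
        quadChar_sq (Units.mk0 (g 1 1) (right_ne_zero_of_mul_eq_one hd))
      have : quadChar q (g 0 0) = quadChar q (g 1 1) := by
        generalize quadChar q (g 0 0) = a at *
        generalize quadChar q (g 1 1) = d at *
        linear_combination d * e - a * h1
      rw [this]
      rfl
    · have hd := g.det_coe
      rw [Matrix.det_fin_two] at hd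
      -- This is the Bruhat decomposition of an element of the big cell, whose coset is determined
      -- by the ratio of the bottom row.
      have e : g = borelElt (-(Units.mk0 _ h)⁻¹) (-(g 0 0)) *
          (weyl q * upper (g 1 1 / g 1 0)) := by
        apply SL2_ext <;> simp [SL2_mul_apply, -ZMod.inv_coe_unit] <;> field_simp
        linear_combination -hd
      conv_rhs => rw [e, seriesFun_borelElt_mul, Units.val_neg, neg_eq_neg_one_mul, map_mul,
        quadChar_inv]
      rfl
  right_inv v := by
    ext i
    rcases i with _ | x
    · simp [seriesExtend]
    · simp [seriesExtend, SL2_mul_apply, quadChar_neg_one_sq]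

instance : FiniteDimensional ℂ (QuadSeries q) := seriesEquiv.symm.finiteDimensional

lemma seriesEquiv_none (φ : QuadSeries q) : seriesEquiv φ none = seriesFun q φ 1 := rfl

lemma seriesEquiv_some (φ : QuadSeries q) (x : ZMod q) :
    seriesEquiv φ (some x) = seriesFun q φ (weyl q * upper x) := rfl

lemma seriesFun_equiv_symm (v : Option (ZMod q) → ℂ) :
    seriesFun q (seriesEquiv.symm v) = seriesExtend v := rfl

/-! ### Traces on the principal series and the character at `(1, 1; 0, 1)` -/

lemma trace_quadSeries_eq_sum (f : Module.End ℂ (QuadSeries q)) :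
    LinearMap.trace ℂ _ f = ∑ i, seriesEquiv (f (seriesEquiv.symm (Pi.single i 1))) i := by
  rw [LinearMap.trace_eq_matrix_trace ℂ (Module.Basis.ofEquivFun seriesEquiv) f, Matrix.trace]
  simp [LinearMap.toMatrix_apply]

lemma hecke_argument_unipotent (y : ZMod q) :
    (upper y * weyl q)⁻¹ * upper 1 = sl2 0 (-1) 1 (1 - y) (by ring) := by
  rw [inv_mul_eq_iff_eq_mul]
  apply SL2_ext <;> simp [SL2_mul_apply]

lemma hecke_argument_weyl (x y : ZMod q) :
    (upper y * weyl q)⁻¹ * (weyl q * upper x) = sl2 1 x y (x * y + 1) (by ring) := by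
  rw [inv_mul_eq_iff_eq_mul]
  apply SL2_ext <;> simp [SL2_mul_apply]
  ring

/-- On `B \ G`, a projective line, `u₁` acts as a translation by `1` and fixes only the point at
infinity. -/
lemma trace_quadSeries_unipotent : LinearMap.trace ℂ _ (quadSeries q (upper 1)) = 1 := by
  rw [trace_quadSeries_eq_sum, Fintype.sum_option, Finset.sum_eq_zero fun x _ => ?_, add_zero]
  · rw [seriesEquiv_none, seriesFun_apply_act, seriesFun_equiv_symm]
    simp [seriesExtend]
  · rw [seriesEquiv_some, seriesFun_apply_act, seriesFun_equiv_symm, mul_assoc, upper_mul_upper]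
    simp only [seriesExtend, SL2_mul_apply, weyl_10, weyl_11, upper_00, upper_10, upper_01,
      upper_11]
    rw [if_neg (by simp), Pi.single_eq_of_ne, mul_zero]
    intro e
    rw [Option.some_inj] at e
    refine one_ne_zero (α := ZMod q) ?_
    field_simp at e
    linear_combination -e

lemma trace_quadSeries_unipotent_mul_hecke :
    LinearMap.trace ℂ _ (quadSeries q (upper 1) * seriesHecke q) = q * quadChar q (-1) := by
  rw [trace_quadSeries_eq_sum, Fintype.sum_option]
  have h0 : seriesEquiv ((quadSeries q (upper 1) * seriesHecke q)
      (seriesEquiv.symm (Pi.single none 1))) none = 0 := by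
    rw [seriesEquiv_none, Module.End.mul_apply, seriesFun_apply_act, seriesFun_hecke_apply, one_mul,
      Finset.sum_eq_zero fun y _ => ?_, mul_zero]
    rw [hecke_argument_unipotent, seriesFun_equiv_symm]
    simp [seriesExtend]
  have h1 (x : ZMod q) : seriesEquiv ((quadSeries q (upper 1) * seriesHecke q)
      (seriesEquiv.symm (Pi.single (some x) 1))) (some x) = quadChar q (-1) := by
    rw [seriesEquiv_some, Module.End.mul_apply, seriesFun_apply_act, seriesFun_hecke_apply,
      -- For `y ≠ 0` the argument lies in the coset with coordinate `x + 1 + 1/y`, which equals `x`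
      -- only for `y = -1`. For `y = 0` it lies in `B`, where the basis vector vanishes.
      mul_assoc, upper_mul_upper, Finset.sum_eq_single (-1)]
    · rw [hecke_argument_weyl, seriesFun_equiv_symm]
      simp [seriesExtend, quadChar_neg_one_sq]
    · intro y _ hy
      rw [hecke_argument_weyl, seriesFun_equiv_symm, seriesExtend]
      split_ifs with h
      · simp
      · rw [Pi.single_eq_of_ne, mul_zero]
        intro e
        apply hy
        rw [sl2_10] at h
        rw [sl2_10, sl2_11, Option.some_inj] at e
        field_simp at e
        linear_combination e
    · simp
  rw [h0, Finset.sum_congr rfl fun x _ => h1 x]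
  simp

lemma isProj_seriesEigen (hq : q ≠ 2) {z : ℂ} (hz : z ^ 2 = q * quadChar q (-1)) (hz0 : z ≠ 0) :
    LinearMap.IsProj (seriesEigen q z).toSubmodule ((2 : ℂ)⁻¹ • (1 + z⁻¹ • seriesHecke q)) where
  map_mem φ := by
    rw [mem_seriesEigen]
    simp only [LinearMap.smul_apply, LinearMap.add_apply, Module.End.one_apply, map_smul, map_add,
      seriesHecke_seriesHecke hq, ← hz, smul_add, smul_smul]
    rw [add_comm]
    congr 2 <;> field_simp
  map_id φ hφ := by
    rw [mem_seriesEigen] at hφ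
    simp only [LinearMap.smul_apply, LinearMap.add_apply, Module.End.one_apply, hφ, smul_smul,
      inv_mul_cancel₀ hz0, one_smul, ← two_smul ℂ φ]
    norm_num

/-- The trace on the eigenspace is that of `u₁` composed with the projection `(1 + z⁻¹ T) / 2`. The
two traces `1` and `q ζ_e(-1) = z²` then give `(1 + z) / 2`. -/
lemma character_seriesEigen_unipotent (hq : q ≠ 2) {z : ℂ} (hz : z ^ 2 = q * quadChar q (-1))
    (hz0 : z ≠ 0) :
    (seriesEigen q z).toRepresentation.character (unipotent q) = (1 + z) / 2 := by
  set p : Module.End ℂ (QuadSeries q) := (2 : ℂ)⁻¹ • (1 + z⁻¹ • seriesHecke q)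
  have hp : LinearMap.IsProj (seriesEigen q z).toSubmodule p := isProj_seriesEigen hq hz hz0
  have hmem (φ : QuadSeries q) :
      (quadSeries q (upper 1) * p) φ ∈ (seriesEigen q z).toSubmodule :=
    (seriesEigen q z).apply_mem_toSubmodule _ (hp.map_mem φ)
  have h1 := LinearMap.trace_restrict_eq_of_forall_mem _ _ hmem
  have h2 : (quadSeries q (upper 1) * p).restrict (fun φ _ => hmem φ) =
      (seriesEigen q z).toRepresentation (unipotent q) := by
    ext φ
    change (quadSeries q (upper 1)) (p φ.1) = quadSeries q (unipotent q) φ.1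
    rw [hp.map_id _ φ.2]
    rfl
  rw [Representation.character, ← h2, h1]
  have h3 : quadSeries q (upper 1) * p = (2 : ℂ)⁻¹ • (quadSeries q (upper 1) +
      z⁻¹ • (quadSeries q (upper 1) * seriesHecke q)) := by
    simp only [p, mul_smul_comm, mul_add, mul_one]
  rw [h3, map_smul, map_add, map_smul, trace_quadSeries_unipotent,
    trace_quadSeries_unipotent_mul_hecke, ← hz, smul_eq_mul, smul_eq_mul]
  field_simp

/-- The vector of `ρ(ζ_e)` supported on the Borel subgroup. -/
def seriesDelta : QuadSeries q := seriesEquiv.symm (Pi.single none 1)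

lemma seriesDelta_apply (g : SL(2, ZMod q)) :
    seriesFun q seriesDelta g = if g 1 0 = 0 then quadChar q (g 1 1) else 0 := by
  rw [seriesDelta, seriesFun_equiv_symm, seriesExtend]
  simp

lemma seriesDelta_mem : seriesDelta ∈ borelEigen (quadSeries q) := by
  intro a c
  apply seriesFun_injective
  ext x
  rw [seriesFun_apply_act, map_smul, Pi.smul_apply, seriesDelta_apply, seriesDelta_apply]
  have h0 : (x * borelElt a c) 1 0 = x 1 0 * a := by simp [SL2_mul_apply]
  rw [h0]
  by_cases h : x 1 0 = 0
  · rw [h, zero_mul, if_pos rfl, if_pos rfl, SL2_mul_apply, h, zero_mul, zero_add, borelElt_11,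
      map_mul, ← Units.val_inv_eq_inv_val, quadChar_inv, mul_comm, smul_eq_mul]
  · rw [if_neg h, if_neg (mul_ne_zero h a.ne_zero), smul_zero]

lemma eq_sum_seriesDelta (φ : QuadSeries q) : φ = seriesFun q φ 1 • seriesDelta +
    ∑ x : ZMod q, seriesFun q φ (weyl q * upper x) •
      quadSeries q (weyl q * upper x)⁻¹ seriesDelta := by
  apply seriesEquiv.injective
  ext i
  rw [map_add, map_sum, Pi.add_apply, Finset.sum_apply]
  simp only [map_smul, Pi.smul_apply]
  rcases i with _ | y
  · rw [Finset.sum_eq_zero fun x _ => ?_]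
    · simp [seriesEquiv_none, seriesDelta_apply]
    · rw [seriesEquiv_none, seriesFun_apply_act, seriesDelta_apply, one_mul, if_neg, smul_zero]
      rw [show (weyl q * upper x)⁻¹ = sl2 (-x) (-1) 1 0 (by ring) from ?_]
      · simp
      · rw [inv_eq_iff_mul_eq_one]
        apply SL2_ext <;> simp [SL2_mul_apply]
  · have e (x : ZMod q) : weyl q * upper y * (weyl q * upper x)⁻¹ =
        sl2 1 0 (x - y) 1 (by ring) := by
      rw [mul_inv_eq_iff_eq_mul]
      apply SL2_ext <;> simp [SL2_mul_apply]
      ring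
    rw [Finset.sum_eq_single y]
    · simp only [seriesEquiv_some, seriesFun_apply_act, seriesDelta_apply, e]
      simp [SL2_mul_apply]
    · intro x _ hx
      simp only [seriesEquiv_some, seriesFun_apply_act, seriesDelta_apply, e]
      simp [sub_ne_zero.mpr hx]
    · simp

/-! ### Irreducibility of the eigenspaces -/

lemma seriesFun_borelEigen {φ : QuadSeries q} (hφ : φ ∈ borelEigen (quadSeries q))
    (g : SL(2, ZMod q)) (x : ZMod q) : seriesFun q φ (g * upper x) = seriesFun q φ g := by
  rw [← seriesFun_apply_act, borelEigen_upper hφ]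

/-- A `(B, ζ_e)`-vector in an eigenspace of the intertwining operator is determined by its value
at the identity. -/
lemma eq_zero_of_seriesEigen {z : ℂ} {φ : QuadSeries q}
    (hφ : φ ∈ borelEigen (quadSeries q)) (hφz : φ ∈ (seriesEigen q z).toSubmodule)
    (h1 : seriesFun q φ 1 = 0) : φ = 0 := by
  have h := congrFun (congrArg (seriesFun q) (mem_seriesEigen.mp hφz)) 1
  -- Evaluated at `1`, the equation `T φ = z φ` reads `q φ(w) = z φ(1)`. So `φ(1) = 0` forces `φ(w)
  -- = 0`, and `φ` vanishes on both double cosets of `B`.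
  have hy (y : ZMod q) : seriesFun q φ ((upper y * weyl q)⁻¹ * 1) =
      quadChar q (-1) * seriesFun q φ (weyl q) := by
    have : (upper y * weyl q)⁻¹ * 1 = borelElt (-1) 0 * weyl q * upper (-y) := by
      rw [inv_mul_eq_iff_eq_mul]
      apply SL2_ext <;> simp [SL2_mul_apply]
    rw [this, seriesFun_borelEigen hφ, seriesFun_borelElt_mul]
    simp
  rw [seriesFun_hecke_apply, map_smul, Pi.smul_apply, h1, smul_zero,
    Finset.sum_congr rfl fun y _ => hy y, Finset.sum_const, Finset.card_univ, ZMod.card,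
    nsmul_eq_mul] at h
  have hw : seriesFun q φ (weyl q) = 0 := by
    have h2 := quadChar_neg_one_sq (q := q)
    have hq0 : (q : ℂ) ≠ 0 := left_ne_zero_of_mul natCast_mul_sub_one_ne_zero
    have hne : quadChar q (-1) ≠ 0 := left_ne_zero_of_mul_eq_one h2
    simpa [hq0, hne] using h
  rw [eq_sum_seriesDelta φ, h1, zero_smul, zero_add]
  refine Finset.sum_eq_zero fun x _ => ?_
  rw [seriesFun_borelEigen hφ, hw, zero_smul]

/-- The eigenspaces of the intertwining operator are irreducible. -/
lemma le_of_le_seriesEigen (hq : q ≠ 2) {z : ℂ} (hz : z ^ 2 = q * quadChar q (-1)) (hz0 : z ≠ 0)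
    (S : Subrepresentation (quadSeries q)) (hS : S.toSubmodule ≤ (seriesEigen q z).toSubmodule)
    (hS0 : S.toSubmodule ≠ ⊥) : S.toSubmodule = (seriesEigen q z).toSubmodule := by
  refine le_antisymm hS ?_
  obtain ⟨φ₀, hφ₀, hne⟩ := Submodule.exists_mem_ne_zero_of_ne_bot hS0
  obtain ⟨φ, hφ, hφ1⟩ : ∃ φ ∈ S.toSubmodule, seriesFun q φ 1 ≠ 0 := by
    by_contra! h
    refine hne (seriesFun_injective ?_)
    ext g
    have := h _ (S.apply_mem_toSubmodule g hφ₀)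
    rwa [seriesFun_apply_act, one_mul] at this
  -- Averaging over `B` stays inside `S` and keeps the nonzero value at `1`.
  set φ' := borelProj (quadSeries q) φ with hφ'
  have hφ'B : φ' ∈ borelEigen (quadSeries q) := (isProj_borelProj _).map_mem φ
  have hφ'S : φ' ∈ S.toSubmodule := by
    rw [hφ', borelProj_apply]
    refine Submodule.smul_mem _ _ (Submodule.sum_mem _ fun a _ => Submodule.sum_mem _ fun c _ =>
      Submodule.smul_mem _ _ (S.apply_mem_toSubmodule _ hφ))
  have hφ'1 : seriesFun q φ' 1 = seriesFun q φ 1 := by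
    have (a : (ZMod q)ˣ) (c : ZMod q) : quadChar q a * seriesFun q φ (1 * borelElt a c) =
        seriesFun q φ 1 := by
      rw [one_mul, ← mul_one (borelElt a c), seriesFun_borelElt_mul, ← mul_assoc, quadChar_sq,
        one_mul]
    rw [hφ', borelProj_apply]
    simp only [map_smul, map_sum, Pi.smul_apply, Finset.sum_apply, seriesFun_apply_act,
      smul_eq_mul, this, Finset.sum_const, Finset.card_univ, ZMod.card, nsmul_eq_mul,
      card_units_zmod]
    have := natCast_mul_sub_one_ne_zero (q := q)
    rw [mul_left_comm (q - 1 : ℂ), ← mul_assoc (q : ℂ), inv_mul_cancel_left₀ this]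
  set p : Module.End ℂ (QuadSeries q) := (2 : ℂ)⁻¹ • (1 + z⁻¹ • seriesHecke q) with hp_def
  have hp : LinearMap.IsProj (seriesEigen q z).toSubmodule p := isProj_seriesEigen hq hz hz0
  have hpg (g : SL(2, ZMod q)) (ψ : QuadSeries q) : p (quadSeries q g ψ) = quadSeries q g (p ψ) := by
    simp [hp_def, seriesHecke_comm]
  -- The `(B, ζ_e)`-vectors of the eigenspace form at most a line, so the projection of
  -- `seriesDelta` is a multiple of `φ'`. Its translates span the eigenspace because those of
  -- `seriesDelta` span `ρ(ζ_e)`.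
  have hδ : p seriesDelta ∈ S.toSubmodule := by
    have : p seriesDelta - (seriesFun q (p seriesDelta) 1 / seriesFun q φ' 1) • φ' = 0 := by
      refine eq_zero_of_seriesEigen (z := z) (sub_mem (fun a c => ?_)
        (Submodule.smul_mem _ _ hφ'B)) (sub_mem (hp.map_mem _)
        (Submodule.smul_mem _ _ (hS hφ'S))) ?_
      · rw [← hpg, seriesDelta_mem, map_smul]
      · rw [map_sub, map_smul, Pi.sub_apply, Pi.smul_apply, smul_eq_mul,
          div_mul_cancel₀ _ (hφ'1 ▸ hφ1), sub_self]
    rw [sub_eq_zero.mp this]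
    exact Submodule.smul_mem _ _ hφ'S
  intro ψ hψ
  rw [← hp.map_id ψ hψ, eq_sum_seriesDelta ψ, map_add, map_sum, map_smul]
  refine add_mem (Submodule.smul_mem _ _ hδ) (Submodule.sum_mem _ fun x _ => ?_)
  rw [map_smul, hpg]
  exact Submodule.smul_mem _ _ (S.apply_mem_toSubmodule _ hδ)

end PrincipalSeries

/-! ### The constituents of the principal series of the quadratic character -/

section Constituents

variable {q : ℕ} [Fact q.Prime]

/-- The projection of `seriesDelta` has value `1/2` at the identity, since `T seriesDelta` vanishes
there. -/
lemma seriesEigen_ne_bot (hq : q ≠ 2) {z : ℂ} (hz : z ^ 2 = q * quadChar q (-1)) (hz0 : z ≠ 0) :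
    (seriesEigen q z).toSubmodule ≠ ⊥ := by
  intro h
  have hp := (isProj_seriesEigen hq hz hz0).map_mem seriesDelta
  rw [h, Submodule.mem_bot] at hp
  have h1 := congrFun (congrArg (seriesFun q) hp) 1
  have hT : seriesFun q (seriesHecke q seriesDelta) 1 = 0 := by
    rw [seriesFun_hecke_apply, Finset.sum_eq_zero fun y _ => ?_, mul_zero]
    have : (upper y * weyl q)⁻¹ * 1 = sl2 0 (-1) 1 (-y) (by ring) := by
      rw [inv_mul_eq_iff_eq_mul]
      apply SL2_ext <;> simp [SL2_mul_apply]
    rw [this, seriesDelta_apply]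
    simp
  simp [hT, seriesDelta_apply] at h1

/-- A subrepresentation disjoint from one eigenspace of the intertwining operator has a copy of the
other one as a quotient, and maps injectively to it. -/
lemma character_unipotent_of_disjoint (hq : q ≠ 2) {z : ℂ} (hz : z ^ 2 = q * quadChar q (-1))
    (hz0 : z ≠ 0) (W : Subrepresentation (quadSeries q)) (hW : W.toSubmodule ≠ ⊥)
    (hd : ∀ φ ∈ W.toSubmodule, seriesHecke q φ = -z • φ → φ = 0) :
    W.toRepresentation.character (unipotent q) = (1 + z) / 2 := by
  have hT (φ : QuadSeries q) : (seriesHecke q + z • 1) φ ∈ (seriesEigen q z).toSubmodule := by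
    rw [mem_seriesEigen]
    simp only [LinearMap.smul_apply, LinearMap.add_apply, Module.End.one_apply, map_smul, map_add,
      seriesHecke_seriesHecke hq, ← hz, smul_add, smul_smul]
    rw [add_comm, sq]
  have hTg (g : SL(2, ZMod q)) (φ : QuadSeries q) : (seriesHecke q + z • 1) (quadSeries q g φ) =
      quadSeries q g ((seriesHecke q + z • 1) φ) := by
    simp [seriesHecke_comm]
  let f : W.toSubmodule →ₗ[ℂ] (seriesEigen q z).toSubmodule :=
    ((seriesHecke q + z • 1).domRestrict W.toSubmodule).codRestrict _ fun φ => hT φ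
  have hf (φ : W.toSubmodule) : (f φ : QuadSeries q) = (seriesHecke q + z • 1) (φ : QuadSeries q) :=
    rfl
  have hinj : Function.Injective f := by
    rw [← LinearMap.ker_eq_bot, LinearMap.ker_eq_bot']
    intro φ hφ
    apply Subtype.ext
    refine hd _ φ.2 ?_
    have : (seriesHecke q + z • 1) (φ : QuadSeries q) = 0 := by rw [← hf, hφ]; rfl
    rw [LinearMap.add_apply, add_eq_zero_iff_eq_neg] at this
    rw [this]
    simp
  let S : Subrepresentation (quadSeries q) :=
    { toSubmodule := W.toSubmodule.map (seriesHecke q + z • 1)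
      apply_mem_toSubmodule := by
        rintro g _ ⟨φ, hφ, rfl⟩
        exact ⟨_, W.apply_mem_toSubmodule g hφ, hTg g φ⟩ }
  have hS : S.toSubmodule = (seriesEigen q z).toSubmodule := by
    refine le_of_le_seriesEigen hq hz hz0 S ?_ ?_
    · rintro _ ⟨φ, -, rfl⟩
      exact hT φ
    · obtain ⟨φ, hφ, hφ0⟩ := Submodule.exists_mem_ne_zero_of_ne_bot hW
      refine (Submodule.ne_bot_iff _).mpr ⟨_, ⟨φ, hφ, rfl⟩, fun h => hφ0 ?_⟩
      have : f ⟨φ, hφ⟩ = 0 := Subtype.ext h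
      exact congrArg Subtype.val ((map_eq_zero_iff f hinj).mp this)
  have hsurj : Function.Surjective f := by
    rintro ⟨ψ, hψ⟩
    rw [← hS] at hψ
    obtain ⟨φ, hφ, rfl⟩ := hψ
    exact ⟨⟨φ, hφ⟩, rfl⟩
  let e := LinearEquiv.ofBijective f ⟨hinj, hsurj⟩
  rw [← character_seriesEigen_unipotent hq hz hz0, Representation.character,
    Representation.character, ← LinearMap.trace_conj' (W.toRepresentation (unipotent q)) e]
  congr 1
  ext ψ
  obtain ⟨φ, rfl⟩ := e.surjective ψ
  rw [LinearEquiv.conj_apply_apply, LinearEquiv.symm_apply_apply]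
  exact hTg _ _

variable (q) in
/-- The signed root `± √(q ζ_e(-1))`. -/
def signedRoot (s : ℤˣ) : ℂ := ((s : ℤ) : ℂ) * sqrtQEps q

lemma signedRoot_sq (hq : q ≠ 2) (s : ℤˣ) : signedRoot q s ^ 2 = q * quadChar q (-1) := by
  have h : sqrtQEps q ^ 2 = q * quadChar q (-1) := by
    rw [← gaussSum_quadChar hq, gaussSum_sq (χ := quadChar q) (quadChar_ne_one hq)
      quadChar_isQuadratic (ZMod.isPrimitive_stdAddChar q), ZMod.card, mul_comm]
  rw [signedRoot, mul_pow, h]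
  rcases Int.units_eq_one_or s with rfl | rfl <;> simp

lemma signedRoot_ne_zero (hq : q ≠ 2) (s : ℤˣ) : signedRoot q s ≠ 0 := by
  intro h
  have h1 := signedRoot_sq hq s
  have h2 := quadChar_neg_one_sq (q := q)
  have hq0 : (q : ℂ) ≠ 0 := left_ne_zero_of_mul natCast_mul_sub_one_ne_zero
  rw [h, zero_pow two_ne_zero] at h1
  exact mul_ne_zero hq0 (left_ne_zero_of_mul_eq_one h2) h1.symm

/-- An irreducible `W` meeting the `z`-eigenspace coincides with it. Otherwise `T - z` maps `W`
isomorphically onto the `(-z)`-eigenspace, and the character value would be `(1 - z) / 2`. -/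
lemma isHalfConstituent_iff (hq : q ≠ 2) (s : ℤˣ) (W : Subrepresentation (quadSeries q)) :
    IsHalfConstituent q s W ↔ W = seriesEigen q (signedRoot q s) := by
  set z := signedRoot q s with hzdef
  have hz : z ^ 2 = q * quadChar q (-1) := signedRoot_sq hq s
  have hz0 : z ≠ 0 := signedRoot_ne_zero hq s
  have hz' : (-z) ^ 2 = q * quadChar q (-1) := by rw [neg_sq, hz]
  have hz0' : -z ≠ 0 := neg_ne_zero.mpr hz0
  have hne : (1 + z) / 2 ≠ (1 + -z) / 2 := by
    intro h
    apply hz0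
    linear_combination h
  constructor
  · rintro ⟨hirr, hchar⟩
    obtain ⟨hW0, hW⟩ := (isIrreducible_toRepresentation_iff W).mp hirr
    have key {y : ℂ} (hy : y ^ 2 = q * quadChar q (-1)) (hy0 : y ≠ 0)
        (h : (W ⊓ seriesEigen q y).toSubmodule ≠ ⊥) : W = seriesEigen q y := by
      apply Subrepresentation.toSubmodule_injective
      rw [← hW _ inf_le_left h, le_of_le_seriesEigen hq hy hy0 _ inf_le_right h]
    by_cases h1 : (W ⊓ seriesEigen q z).toSubmodule = ⊥
    · exfalso
      have hc1 := character_unipotent_of_disjoint hq hz' hz0' W hW0 (fun φ hφ h => by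
        have : φ ∈ (W ⊓ seriesEigen q z).toSubmodule :=
          ⟨hφ, mem_seriesEigen.mpr (by rw [h, neg_neg])⟩
        rwa [h1, Submodule.mem_bot] at this)
      exact hne (hchar.symm.trans hc1)
    · exact key hz hz0 h1
  · rintro rfl
    refine ⟨(isIrreducible_toRepresentation_iff _).mpr ⟨seriesEigen_ne_bot hq hz hz0,
      le_of_le_seriesEigen hq hz hz0⟩, character_seriesEigen_unipotent hq hz hz0⟩

lemma quadConstituent_eq (hq : q ≠ 2) (s : ℤˣ) :
    quadConstituent q s = seriesEigen q (signedRoot q s) := by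
  apply Subrepresentation.toSubmodule_injective
  change (⨆ (W : Subrepresentation (principalSeries q (quadChar q)))
    (_ : IsHalfConstituent q s W), W.toSubmodule) = _
  simp only [isHalfConstituent_iff hq, iSup_iSup_eq_left]

lemma mem_quadConstituent (hq : q ≠ 2) {s : ℤˣ} {φ : QuadSeries q} :
    φ ∈ (quadConstituent q s).toSubmodule ↔ seriesHecke q φ = signedRoot q s • φ := by
  rw [quadConstituent_eq hq, mem_seriesEigen]

end Constituents

/-! ### Finite-dimensionality of spaces of cusp forms -/

section FiniteDimension

/-- In a finite-dimensional space with a separating family of functionals, finitely many of them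
separate. -/
lemma exists_finset_separating {ι W : Type*} [AddCommGroup W] [Module ℂ W] [FiniteDimensional ℂ W]
    (ev : ι → W →ₗ[ℂ] ℂ) (h : ∀ w, (∀ i, ev i w = 0) → w = 0) :
    ∃ S : Finset ι, ∀ w, (∀ i ∈ S, ev i w = 0) → w = 0 := by
  -- By the descending chain condition on subspaces, the intersection of all the kernels is already
  -- a finite one.
  obtain ⟨S, hS⟩ := Finset.exists_inf_le fun i => LinearMap.ker (ev i)
  refine ⟨S, fun w hw => h w fun i => ?_⟩
  have : w ∈ S.inf fun i => LinearMap.ker (ev i) := by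
    rw [Submodule.mem_finsetInf]
    exact hw
  exact hS i this

/-- The space of cusp forms of given weight for an arithmetic group is finite-dimensional: by means
of the norm to level one, a form is determined by its values at finitely many points. -/
lemma finiteDimensional_cuspForm (Γ : Subgroup (GL (Fin 2) ℝ)) [Γ.IsArithmetic] [Γ.HasDetOne]
    (k : ℤ) : FiniteDimensional ℂ (CuspForm Γ k) := by
  -- The norm is a product over the cosets, so its weight is `k` times their number. One factor is
  -- the form itself, so the norm vanishes wherever the form does.
  let K : ℤ := k * Nat.card (𝒮ℒ ⧸ Γ.subgroupOf 𝒮ℒ)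
  let ev (z : ℍ) : ModularForm 𝒮ℒ K →ₗ[ℂ] ℂ :=
    { toFun f := f z
      map_add' _ _ := rfl
      map_smul' _ _ := rfl }
  obtain ⟨S, hS⟩ := exists_finset_separating ev fun f hf => by
    ext z
    exact hf z
  let res : CuspForm Γ k →ₗ[ℂ] (S → ℂ) :=
    { toFun f z := f z
      map_add' _ _ := rfl
      map_smul' _ _ := rfl }
  refine FiniteDimensional.of_injective res ?_
  rw [← LinearMap.ker_eq_bot, LinearMap.ker_eq_bot']
  intro f hf
  have h0 : ModularForm.norm 𝒮ℒ f = 0 := by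
    refine hS _ fun z hz => ?_
    change ModularForm.norm 𝒮ℒ f z = 0
    have hfz : f z = 0 := congrFun hf ⟨z, hz⟩
    simpa [ModularForm.coe_norm, Finset.prod_eq_zero_iff, QuotientGroup.exists_mk] using
      ⟨1, by simpa using hfz⟩
  exact DFunLike.coe_injective ((ModularForm.norm_eq_zero_iff 𝒮ℒ f).mp h0)

end FiniteDimension

/-! ### Surjectivity of the reduction map -/

section Reduction

variable {q : ℕ} [Fact q.Prime]

lemma reduction_apply (γ : SL(2, ℤ)) (i j : Fin 2) : reduction q γ i j = (γ i j : ZMod q) := rfl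

lemma reduction_surjective : Function.Surjective (reduction q) := by
  rw [← MonoidHom.range_eq_top, Subgroup.eq_top_iff']
  have hu (x : ZMod q) : upper x ∈ (reduction q).range := by
    obtain ⟨n, rfl⟩ := ZMod.intCast_surjective x
    let γ : SL(2, ℤ) := ⟨!![1, n; 0, 1], by simp⟩
    refine ⟨γ, ?_⟩
    apply SL2_ext <;> rw [reduction_apply] <;> simp [γ]
  have hw : weyl q ∈ (reduction q).range := by
    let γ : SL(2, ℤ) := ⟨!![0, 1; -1, 0], by simp⟩
    refine ⟨γ, ?_⟩
    apply SL2_ext <;> rw [reduction_apply] <;> simp [γ]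
  have key (g : SL(2, ZMod q)) (h : g 1 0 ≠ 0) : g ∈ (reduction q).range := by
    have hd := g.det_coe
    rw [Matrix.det_fin_two] at hd
    -- A matrix with nonzero lower left entry is upper times lower times upper unipotent, and the
    -- lower one is a Weyl conjugate of an upper one; all of these lift to `SL₂(ℤ)`.
    have : g = upper ((g 0 0 - 1) / g 1 0) * (weyl q * upper (-(g 1 0)) * (weyl q)⁻¹) *
        upper ((g 1 1 - 1) / g 1 0) := by
      have e : weyl q * upper (-(g 1 0)) * (weyl q)⁻¹ = sl2 1 0 (g 1 0) 1 (by ring) := by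
        rw [mul_inv_eq_iff_eq_mul]
        apply SL2_ext <;> simp [SL2_mul_apply]
      rw [e]
      apply SL2_ext <;> simp [SL2_mul_apply] <;> field_simp
      · ring
      · linear_combination -hd
      · ring
    rw [this]
    exact mul_mem (mul_mem (hu _) (mul_mem (mul_mem hw (hu _)) (inv_mem hw))) (hu _)
  intro g
  by_cases h : g 1 0 = 0
  · have hd := g.det_coe
    rw [Matrix.det_fin_two, h, mul_zero, sub_zero] at hd
    rw [← inv_mul_cancel_left (weyl q) g]
    refine mul_mem (inv_mem hw) (key _ ?_)
    rw [SL2_mul_apply, h]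
    simpa using left_ne_zero_of_mul_eq_one hd
  · exact key g h

end Reduction

/-! ### Cusp forms for `Γ(q)` as a representation of `SL₂(𝔽_q)` -/

section Forms

variable {q : ℕ} {k : ℤ}

/-- The restriction of a cusp form to a smaller group. -/
def cuspRestrict {Δ Δ' : Subgroup SL(2, ℤ)} (h : Δ ≤ Δ') :
    CuspForm (Δ' : Subgroup (GL (Fin 2) ℝ)) k →ₗ[ℂ] CuspForm (Δ : Subgroup (GL (Fin 2) ℝ)) k where
  toFun f :=
    { toFun := f
      slash_action_eq' γ hγ := f.slash_action_eq' γ (Subgroup.map_mono h hγ)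
      holo' := f.holo'
      zero_at_cusps' hc := f.zero_at_cusps' (hc.mono (Subgroup.map_mono h)) }
  map_add' _ _ := rfl
  map_smul' _ _ := rfl

lemma isCusp_of_isCusp (Δ Δ' : Subgroup SL(2, ℤ)) [Δ'.FiniteIndex] {c : OnePoint ℝ}
    (hc : IsCusp c (Δ : Subgroup (GL (Fin 2) ℝ))) : IsCusp c (Δ' : Subgroup (GL (Fin 2) ℝ)) := by
  rw [Subgroup.IsArithmetic.isCusp_iff_isCusp_SL2Z]
  exact hc.mono (Subgroup.map_le_range _ _)

/-- A cusp form which is invariant under a larger group. -/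
def cuspExtend {Δ : Subgroup SL(2, ℤ)} [Δ.FiniteIndex] (Δ' : Subgroup SL(2, ℤ))
    (f : CuspForm (Δ : Subgroup (GL (Fin 2) ℝ)) k) (h : ∀ γ ∈ Δ', ⇑f ∣[k] γ = ⇑f) :
    CuspForm (Δ' : Subgroup (GL (Fin 2) ℝ)) k where
  toFun := f
  slash_action_eq' := by
    rintro _ ⟨γ, hγ, rfl⟩
    exact h γ hγ
  holo' := f.holo'
  zero_at_cusps' hc := f.zero_at_cusps' (isCusp_of_isCusp Δ' Δ hc)

lemma slash_eq_of_mem {Δ : Subgroup SL(2, ℤ)} (f : CuspForm (Δ : Subgroup (GL (Fin 2) ℝ)) k)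
    {γ : SL(2, ℤ)} (hγ : γ ∈ Δ) : ⇑f ∣[k] γ = ⇑f :=
  f.slash_action_eq' _ ⟨γ, hγ, rfl⟩

variable [NeZero q]

/-- The slash action of `SL₂(ℤ)` on the cusp forms for `Γ(q)`. -/
def cuspSlash (γ : SL(2, ℤ)) : Module.End ℂ (CuspForm (Gamma q : Subgroup (GL (Fin 2) ℝ)) k) where
  toFun f :=
    { toFun := ⇑f ∣[k] γ
      slash_action_eq' := by
        rintro _ ⟨δ, hδ, rfl⟩
        change (⇑f ∣[k] γ) ∣[k] δ = ⇑f ∣[k] γ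
        -- Normality of `Γ(q)` makes the translate invariant under `Γ(q)` again.
        have := slash_eq_of_mem f ((Gamma_normal q).conj_mem δ hδ γ)
        conv_rhs => rw [← this]
        rw [← SlashAction.slash_mul, ← SlashAction.slash_mul, inv_mul_cancel_right]
      holo' := (CuspForm.translate f (γ : GL (Fin 2) ℝ)).holo'
      zero_at_cusps' := fun {c} hc => by
        have h : IsCusp ((γ : GL (Fin 2) ℝ) • c) (Gamma q : Subgroup (GL (Fin 2) ℝ)) := by
          rw [Subgroup.IsArithmetic.isCusp_iff_isCusp_SL2Z] at hc ⊢
          exact hc.smul_of_mem ⟨γ, rfl⟩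
        exact OnePoint.IsZeroAt.smul_iff.mp (f.zero_at_cusps' h) }
  map_add' f g := by
    ext z
    exact congrFun (SlashAction.add_slash k γ (⇑f) (⇑g)) z
  map_smul' c f := by
    ext z
    exact congrFun (SL_smul_slash k γ (⇑f) c) z

@[simp] lemma coe_cuspSlash (γ : SL(2, ℤ))
    (f : CuspForm (Gamma q : Subgroup (GL (Fin 2) ℝ)) k) : ⇑(cuspSlash γ f) = ⇑f ∣[k] γ := rfl

lemma cuspSlash_mul (γ δ : SL(2, ℤ)) :
    cuspSlash (q := q) (k := k) (γ * δ) = cuspSlash δ * cuspSlash γ := by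
  ext f z
  simp [SlashAction.slash_mul]

lemma cuspSlash_one : cuspSlash (q := q) (k := k) 1 = 1 := by
  ext f z
  simp

lemma cuspSlash_eq_of_reduction_eq {γ δ : SL(2, ℤ)} (h : reduction q γ = reduction q δ) :
    cuspSlash (q := q) (k := k) γ = cuspSlash δ := by
  have hm : γ * δ⁻¹ ∈ Gamma q := by
    change reduction q _ = 1
    rw [map_mul, map_inv, h, mul_inv_cancel]
  have : cuspSlash (q := q) (k := k) (γ * δ⁻¹) = 1 := by
    ext f z
    exact congrFun (slash_eq_of_mem f hm) z
  rw [← inv_mul_cancel_right γ δ, cuspSlash_mul, this, mul_one]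

end Forms

section FormsRep

variable (q : ℕ) [Fact q.Prime] (k : ℤ)

/-- The representation of `SL₂(𝔽_q)` on the cusp forms for `Γ(q)`. -/
def formsRep : Representation ℂ SL(2, ZMod q) (CuspForm (Gamma q : Subgroup (GL (Fin 2) ℝ)) k) where
  -- The choice of the lift is immaterial because `Γ(q)` acts trivially, and the inverse turns the
  -- right slash action into a left one.
  toFun g := cuspSlash (Function.surjInv reduction_surjective g)⁻¹
  map_one' := by
    rw [← cuspSlash_one]
    apply cuspSlash_eq_of_reduction_eq
    rw [map_inv, Function.surjInv_eq reduction_surjective, map_one, inv_one]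
  map_mul' g h := by
    rw [← cuspSlash_mul]
    apply cuspSlash_eq_of_reduction_eq
    simp only [map_inv, map_mul, Function.surjInv_eq reduction_surjective, mul_inv_rev]

variable {q k}

lemma formsRep_reduction (γ : SL(2, ℤ)) : formsRep q k (reduction q γ) = cuspSlash γ⁻¹ := by
  apply cuspSlash_eq_of_reduction_eq
  rw [map_inv, map_inv, Function.surjInv_eq reduction_surjective]

lemma coe_formsRep_reduction (γ : SL(2, ℤ)) (f : CuspForm (Gamma q : Subgroup (GL (Fin 2) ℝ)) k) :
    ⇑(formsRep q k (reduction q γ) f) = ⇑f ∣[k] γ⁻¹ := by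
  rw [formsRep_reduction, coe_cuspSlash]

instance : FiniteDimensional ℂ (CuspForm (Gamma q : Subgroup (GL (Fin 2) ℝ)) k) :=
  finiteDimensional_cuspForm _ k

/-- `Γ₁(q)` is the preimage of the unipotent radical under reduction. -/
lemma cuspFormsGamma1_eq (n : ZMod q) :
    cuspFormsGamma1 q k n = unipotentEigen (formsRep q k) n := by
  ext f
  constructor
  · intro h x
    obtain ⟨γ, hγ⟩ := reduction_surjective (upper x)
    have h01 : (γ 0 1 : ZMod q) = x := by rw [← reduction_apply, hγ, upper_01]
    have hm : γ ∈ Gamma1 q := by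
      rw [Gamma1_mem, ← reduction_apply, ← reduction_apply, ← reduction_apply, hγ]
      simp
    apply DFunLike.coe_injective
    rw [← hγ, coe_formsRep_reduction]
    refine (h γ hm).trans ?_
    change ZMod.stdAddChar (n * ((γ 0 1 : ℤ) : ZMod q)) • ⇑f = _
    rw [h01]
    rfl
  · intro h γ hγ
    have : reduction q γ = upper (γ 0 1 : ZMod q) := by
      rw [Gamma1_mem] at hγ
      exact SL2_ext hγ.1 rfl hγ.2.2 hγ.2.1
    have h := h (γ 0 1 : ZMod q)
    rw [← this] at h
    rw [← coe_formsRep_reduction, h]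
    rfl

/-- `Γ₀(q)` is the preimage of `B`, and `ζ_e(d) = ζ_e(a)` because `d = a⁻¹` modulo `q`. -/
lemma borelEigen_formsRep_iff (f : CuspForm (Gamma q : Subgroup (GL (Fin 2) ℝ)) k) :
    f ∈ borelEigen (formsRep q k) ↔
      ∀ γ ∈ Gamma0 q, ⇑f ∣[k] γ⁻¹ = quadChar q (γ 1 1 : ZMod q) • ⇑f := by
  constructor
  · intro h γ hγ
    obtain ⟨a, c, hac⟩ := eq_borelElt (b := reduction q γ) hγ
    rw [← coe_formsRep_reduction, hac, h a c, ← reduction_apply, hac, borelElt_11,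
      ← Units.val_inv_eq_inv_val, quadChar_inv]
    rfl
  · intro h a c
    obtain ⟨γ, hγ⟩ := reduction_surjective (borelElt a c)
    have hm : γ ∈ Gamma0 q := by
      rw [Gamma0_mem, ← reduction_apply, hγ, borelElt_10]
    apply DFunLike.coe_injective
    rw [← hγ, coe_formsRep_reduction, h γ hm, ← reduction_apply, hγ, borelElt_11,
      ← Units.val_inv_eq_inv_val, quadChar_inv]
    rfl

lemma Gamma_le_Gamma1 (N : ℕ) : Gamma N ≤ Gamma1 N := fun γ hγ => by
  rw [Gamma_mem] at hγ
  rw [Gamma1_mem]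
  exact ⟨hγ.1, hγ.2.2.2, hγ.2.2.1⟩

/-- Cusp forms for `Γ₀(q)` with quadratic character as `(B, ζ_e)`-vectors. -/
def cuspFormsGamma0Equiv : cuspFormsGamma0 q k (quadChar q) ≃ₗ[ℂ] borelEigen (formsRep q k) :=
  LinearEquiv.ofBijective
    (((cuspRestrict (Gamma_le_Gamma1 q)).domRestrict (cuspFormsGamma0 q k (quadChar q))).codRestrict
      (borelEigen (formsRep q k)) fun f => (borelEigen_formsRep_iff _).mpr f.2) <| by
  constructor
  · intro f g h
    have h' : cuspRestrict (Gamma_le_Gamma1 q) f.1 = cuspRestrict (Gamma_le_Gamma1 q) g.1 :=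
      congrArg Subtype.val h
    have h'' : (⇑f.1 : ℍ → ℂ) = ⇑g.1 := congrArg (fun F : CuspForm (Gamma q : Subgroup (GL (Fin 2) ℝ)) k => (⇑F : ℍ → ℂ)) h'
    exact Subtype.ext (DFunLike.coe_injective h'')
  · rintro ⟨f, hf⟩
    rw [borelEigen_formsRep_iff] at hf
    have hinv (γ : SL(2, ℤ)) (hγ : γ ∈ Gamma1 q) : ⇑f ∣[k] γ = ⇑f := by
      have hγ' := (Gamma1_mem q _).mp (inv_mem hγ)
      have := hf γ⁻¹ (Gamma0_mem.mpr hγ'.2.2)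
      rwa [inv_inv, hγ'.2.1, map_one, one_smul] at this
    exact ⟨⟨cuspExtend (Gamma1 q) f hinv, hf⟩, rfl⟩

end FormsRep

/-! ### Vector-valued cusp forms for `ρ(ζ_e)^±` -/

section VectorValued

lemma Gamma_le_ker {N : ℕ} {V : Type*} [AddCommGroup V] [Module ℂ V]
    (ρ : Representation ℂ SL(2, ZMod N) V) :
    Gamma N ≤ MonoidHom.ker (MonoidHom.comp ρ (reduction N)) := by
  intro γ hγ
  have : reduction N γ = 1 := hγ
  rw [MonoidHom.mem_ker, MonoidHom.comp_apply, this, map_one]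

variable {q : ℕ} [Fact q.Prime] {k : ℤ} {s : ℤˣ}

/-- The vectors of `ρ(ζ_e)^±` as functions on `SL₂(𝔽_q)`. -/
def quadFun (s : ℤˣ) : QuadSpace q s →ₗ[ℂ] (SL(2, ZMod q) → ℂ) :=
  seriesFun q ∘ₗ (quadConstituent q s).toSubmodule.subtype

lemma quadFun_injective : Function.Injective (quadFun (q := q) s) :=
  seriesFun_injective.comp Subtype.val_injective

lemma quadFun_apply_act (g x : SL(2, ZMod q)) (φ : QuadSpace q s) :
    quadFun s (rhoQuad q s g φ) x = quadFun s φ (x * g) := rfl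

lemma seriesMk_mem_quadConstituent (hq : q ≠ 2) {φ : SL(2, ZMod q) → ℂ}
    (h : φ ∈ heckeEigen (leftReg q) (signedRoot q s)) :
    seriesMk φ ((mem_heckeEigen _).mp h).1 ∈ (quadConstituent q s).toSubmodule :=
  (mem_quadConstituent hq).mpr (seriesFun_injective ((mem_heckeEigen _).mp h).2)

/-- An eigenfunction of the Hecke operator, as a vector of `ρ(ζ_e)^±`. -/
def quadMk (hq : q ≠ 2) (φ : SL(2, ZMod q) → ℂ)
    (h : φ ∈ heckeEigen (leftReg q) (signedRoot q s)) : QuadSpace q s :=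
  ⟨seriesMk φ ((mem_heckeEigen _).mp h).1, seriesMk_mem_quadConstituent hq h⟩

lemma quadFun_mk (hq : q ≠ 2) (φ : SL(2, ZMod q) → ℂ)
    (h : φ ∈ heckeEigen (leftReg q) (signedRoot q s)) : quadFun s (quadMk hq φ h) = φ := rfl

lemma quadFun_mem (hq : q ≠ 2) (v : QuadSpace q s) :
    quadFun s v ∈ heckeEigen (leftReg q) (signedRoot q s) :=
  (mem_heckeEigen _).mpr ⟨seriesFun_mem v.1, by
    have h := congrArg (seriesFun q) ((mem_quadConstituent hq).mp v.2)
    rw [map_smul, seriesFun_hecke] at h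
    exact h⟩

/-- The representation space embeds into the functions on a finite group, so a functional on it
extends and becomes a combination of point evaluations. This reduces cuspidality of all coordinates
to that of the translates of one form. -/
lemma exists_eq_sum_quadFun (ℓ : QuadSpace q s →ₗ[ℂ] ℂ) :
    ∃ c : SL(2, ZMod q) → ℂ, ∀ v, ℓ v = ∑ x, c x * quadFun s v x := by
  obtain ⟨r, hr⟩ := (quadFun (q := q) s).exists_leftInverse_of_injective
    (LinearMap.ker_eq_bot.mpr quadFun_injective)
  refine ⟨fun x => ℓ (r (Pi.single x 1)), fun v => ?_⟩
  have hv : r (quadFun s v) = v := LinearMap.congr_fun hr v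
  conv_lhs => rw [← hv]
  rw [← LinearMap.comp_apply, LinearMap.pi_apply_eq_sum_univ]
  refine Finset.sum_congr rfl fun x _ => ?_
  have hx : (fun y => if x = y then (1 : ℂ) else 0) = Pi.single x 1 := by
    ext y
    simp [Pi.single_apply, eq_comm]
  rw [smul_eq_mul, mul_comm, hx, LinearMap.comp_apply]

/-- The function on `SL₂(𝔽_q)` which records the values of the translates of a cusp form at a
point of the upper half plane. -/
def formValues (τ : ℍ) :
    CuspForm (Gamma q : Subgroup (GL (Fin 2) ℝ)) k →ₗ[ℂ] (SL(2, ZMod q) → ℂ) where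
  toFun h x := formsRep q k x⁻¹ h τ
  map_add' _ _ := by ext; simp
  map_smul' _ _ := by ext; simp

lemma formValues_act (τ : ℍ) (g : SL(2, ZMod q))
    (h : CuspForm (Gamma q : Subgroup (GL (Fin 2) ℝ)) k) :
    formValues τ (formsRep q k g h) = leftReg q g (formValues τ h) := by
  ext x
  change formsRep q k x⁻¹ (formsRep q k g h) τ = formsRep q k (g⁻¹ * x)⁻¹ h τ
  rw [mul_inv_rev, inv_inv, map_mul]
  rfl

lemma formValues_hecke (τ : ℍ) (h : CuspForm (Gamma q : Subgroup (GL (Fin 2) ℝ)) k) :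
    formValues τ (hecke (formsRep q k) h) = hecke (leftReg q) (formValues τ h) := by
  simp only [hecke_apply, map_smul, map_sum, formValues_act]

lemma formValues_ext {h h' : CuspForm (Gamma q : Subgroup (GL (Fin 2) ℝ)) k}
    (e : ∀ τ, formValues τ h = formValues τ h') : h = h' := by
  ext τ
  have : formsRep q k 1⁻¹ h τ = formsRep q k 1⁻¹ h' τ := congrFun (e τ) 1
  simpa using this

/-- The maps `formValues τ` intertwine `formsRep` with `leftReg` and are jointly injective, so the
eigenvector conditions can be tested at each `τ`. -/
lemma mem_heckeEigen_formsRep {z : ℂ} {h : CuspForm (Gamma q : Subgroup (GL (Fin 2) ℝ)) k} :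
    h ∈ heckeEigen (formsRep q k) z ↔ ∀ τ, formValues τ h ∈ heckeEigen (leftReg q) z := by
  simp only [mem_heckeEigen]
  constructor
  · rintro ⟨h1, h2⟩ τ
    refine ⟨fun a c => ?_, ?_⟩
    · rw [← formValues_act, h1, map_smul]
    · rw [← formValues_hecke, h2, map_smul]
  · intro e
    refine ⟨fun a c => formValues_ext fun τ => ?_, formValues_ext fun τ => ?_⟩
    · rw [formValues_act, (e τ).1, map_smul]
    · rw [formValues_hecke, (e τ).2, map_smul]

lemma formValues_reduction (τ : ℍ) (h : CuspForm (Gamma q : Subgroup (GL (Fin 2) ℝ)) k)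
    (γ : SL(2, ℤ)) :
    formValues τ h (reduction q γ) = h (γ • τ) * denom γ τ ^ (-k) := by
  change formsRep q k (reduction q γ)⁻¹ h τ = _
  rw [← map_inv, coe_formsRep_reduction, inv_inv, SL_slash_apply]

/-- Moving `τ` by `γ` is right translation by `γ` up to the automorphy factor, and right translation
is the action of `ρ(ζ_e)`. -/
lemma formValues_smul (τ : ℍ) (h : CuspForm (Gamma q : Subgroup (GL (Fin 2) ℝ)) k)
    (γ : SL(2, ℤ)) (x : SL(2, ZMod q)) :
    formValues (γ • τ) h x = denom γ τ ^ k * formValues τ h (x * reduction q γ) := by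
  obtain ⟨δ, rfl⟩ := reduction_surjective x
  have h0 : denom γ τ ≠ 0 := denom_ne_zero _ _
  have e : formValues τ h (reduction q δ * reduction q γ) =
      formValues (γ • τ) h (reduction q δ) * denom γ τ ^ (-k) := by
    change formsRep q k (reduction q δ * reduction q γ)⁻¹ h τ =
      formsRep q k (reduction q δ)⁻¹ h (γ • τ) * denom γ τ ^ (-k)
    rw [mul_inv_rev, map_mul, ← map_inv, ← map_inv, Module.End.mul_apply, coe_formsRep_reduction,
      inv_inv, SL_slash_apply]
  rw [e, mul_left_comm, ← zpow_add₀ h0, add_neg_cancel, zpow_zero, mul_one]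

/-- The vector-valued function attached to an eigenvector of the Hecke operator. -/
def toVectorForm (hq : q ≠ 2) :
    heckeEigen (formsRep q k) (signedRoot q s) →ₗ[ℂ] (ℍ → QuadSpace q s) where
  toFun h τ := quadMk hq (formValues τ h.1) (mem_heckeEigen_formsRep.mp h.2 τ)
  map_add' _ _ := by
    ext τ
    apply quadFun_injective
    simp [quadFun_mk]
  map_smul' _ _ := by
    ext τ
    apply quadFun_injective
    simp [quadFun_mk]

lemma quadFun_toVectorForm (hq : q ≠ 2) (h : heckeEigen (formsRep q k) (signedRoot q s)) (τ : ℍ) :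
    quadFun s (toVectorForm hq h τ) = formValues τ h.1 := rfl

lemma toVectorForm_smul (hq : q ≠ 2) (h : heckeEigen (formsRep q k) (signedRoot q s))
    (γ : SL(2, ℤ)) (τ : ℍ) :
    toVectorForm hq h (γ • τ) = denom γ τ ^ k • rhoQuad q s (reduction q γ) (toVectorForm hq h τ) := by
  apply quadFun_injective
  ext x
  rw [map_smul, Pi.smul_apply, quadFun_apply_act, quadFun_toVectorForm, quadFun_toVectorForm,
    formValues_smul, smul_eq_mul]

lemma toVectorForm_mem (hq : q ≠ 2) (h : heckeEigen (formsRep q k) (signedRoot q s)) :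
    toVectorForm hq h ∈ cuspFormsRep q k (rhoQuad q s) := by
  refine ⟨fun ℓ => ?_, toVectorForm_smul hq h⟩
  obtain ⟨c, hc⟩ := exists_eq_sum_quadFun ℓ
  let F : CuspForm (Gamma q : Subgroup (GL (Fin 2) ℝ)) k := ∑ x, c x • formsRep q k x⁻¹ h.1
  let ev (τ : ℍ) : CuspForm (Gamma q : Subgroup (GL (Fin 2) ℝ)) k →ₗ[ℂ] ℂ :=
    { toFun f := f τ
      map_add' _ _ := rfl
      map_smul' _ _ := rfl }
  have hF (τ : ℍ) : F τ = ℓ (toVectorForm hq h τ) := by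
    change ev τ F = _
    rw [hc, map_sum]
    refine Finset.sum_congr rfl fun x _ => ?_
    rw [map_smul]
    rfl
  -- `F` is only known to be a form for `Γ(q)`. Invariance under the kernel of `ρ`, which may be
  -- larger, comes from the transformation law.
  refine ⟨cuspExtend _ F fun γ hγ => ?_, ?_⟩
  · ext τ
    have h0 : denom γ τ ≠ 0 := denom_ne_zero _ _
    have hγ' : rhoQuad q s (reduction q γ) = 1 := hγ
    rw [SL_slash_apply, hF, hF, toVectorForm_smul, hγ', map_smul, Module.End.one_apply, smul_eq_mul,
      mul_right_comm, ← zpow_add₀ h0, add_neg_cancel, zpow_zero, one_mul]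
  · ext τ
    exact hF τ

/-- Vector-valued cusp forms for `ρ(ζ_e)^±` as eigenvectors of the Hecke operator on the cusp
forms for `Γ(q)`. -/
def heckeEigenEquiv (hq : q ≠ 2) :
    heckeEigen (formsRep q k) (signedRoot q s) ≃ₗ[ℂ] cuspFormsRep q k (rhoQuad q s) :=
  LinearEquiv.ofBijective ((toVectorForm hq).codRestrict _ (toVectorForm_mem hq)) <| by
  constructor
  · intro h h' e
    have e' : toVectorForm hq h = toVectorForm hq h' := congrArg Subtype.val e
    refine Subtype.ext (formValues_ext fun τ => ?_)
    rw [← quadFun_toVectorForm hq, e', quadFun_toVectorForm]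
  · rintro ⟨f, hf⟩
    -- The scalar form is recovered as the value at the identity of `G`. The transformation law
    -- under `SL₂(ℤ)` then gives the values at all other elements.
    obtain ⟨F, hF⟩ := hf.1 (LinearMap.proj 1 ∘ₗ quadFun s)
    let h := cuspRestrict (Gamma_le_ker (rhoQuad q s)) F
    have hh (τ : ℍ) : formValues τ h = quadFun s (f τ) := by
      ext x
      obtain ⟨γ, rfl⟩ := reduction_surjective x
      have h0 : denom γ τ ≠ 0 := denom_ne_zero _ _
      have e : h (γ • τ) = quadFun s (f (γ • τ)) 1 := congrFun hF (γ • τ)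
      have e' : f (γ • τ) = denom γ τ ^ k • rhoQuad q s (reduction q γ) (f τ) := hf.2 γ τ
      rw [formValues_reduction, e, e', map_smul, Pi.smul_apply, quadFun_apply_act, one_mul,
        smul_eq_mul, mul_right_comm, ← zpow_add₀ h0, add_neg_cancel, zpow_zero, one_mul]
    refine ⟨⟨h, mem_heckeEigen_formsRep.mpr fun τ => ?_⟩, Subtype.ext ?_⟩
    · rw [hh]
      exact quadFun_mem hq _
    · ext τ
      apply quadFun_injective
      exact hh τ

/-! ### The action of `-1` and parity -/

lemma neg_one_smul_upperHalfPlane (τ : ℍ) : (-1 : SL(2, ℤ)) • τ = τ := by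
  rw [ModularGroup.SL_neg_smul, one_smul]

lemma denom_neg_one (τ : ℍ) : denom (-1 : SL(2, ℤ)) τ = -1 := by
  simp [denom]

lemma reduction_neg_one : reduction q (-1) = -1 := by
  apply SL2_ext <;> simp [reduction_apply]

lemma rhoQuad_neg_one (v : QuadSpace q s) : rhoQuad q s (-1) v = quadChar q (-1) • v := by
  apply quadFun_injective
  ext x
  rw [quadFun_apply_act, map_smul, mul_neg, mul_one, ← neg_one_mul, neg_one_eq_borelElt]
  have := seriesFun_borelElt_mul v.1 (-1) 0 x
  rw [Units.val_neg, Units.val_one] at this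
  exact this

/-- There are no cusp forms of the wrong parity. -/
lemma cuspFormsRep_eq_bot {k : ℕ} (h : quadChar q (-1) ≠ (-1) ^ k) :
    cuspFormsRep q k (rhoQuad q s) = ⊥ := by
  rw [Submodule.eq_bot_iff]
  intro f hf
  ext τ
  have e : f ((-1 : SL(2, ℤ)) • τ) =
    denom (-1 : SL(2, ℤ)) τ ^ (k : ℤ) • rhoQuad q s (reduction q (-1)) (f τ) := hf.2 (-1) τ
  rw [neg_one_smul_upperHalfPlane, denom_neg_one, reduction_neg_one, rhoQuad_neg_one, zpow_natCast,
    smul_smul] at e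
  by_contra hne
  have h1 : ((-1) ^ k * quadChar q (-1) - 1) • f τ = 0 := by
    rw [sub_smul, ← e, one_smul, sub_self]
  rcases smul_eq_zero.mp h1 with h2 | h2
  · apply h
    have h3 : ((-1 : ℂ) ^ k) * (-1) ^ k = 1 := by rw [← mul_pow]; simp
    linear_combination (-1) ^ k * h2 - quadChar q (-1) * h3
  · exact hne h2

lemma formsRep_neg_one {k : ℕ} (h : quadChar q (-1) = (-1) ^ k) :
    formsRep q k (-1) = quadChar q (-1) • LinearMap.id := by
  ext f τ
  change formsRep q k (-1) f τ = quadChar q (-1) * f τ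
  rw [← reduction_neg_one, coe_formsRep_reduction, SL_slash_apply]
  have : (-1 : SL(2, ℤ))⁻¹ = -1 := by rw [inv_eq_iff_mul_eq_one]; simp
  rw [this, neg_one_smul_upperHalfPlane, denom_neg_one, h, mul_comm, zpow_neg, zpow_natCast,
    ← inv_pow, inv_neg_one]

end VectorValued

end CuspRep

end

theorem proposition3 (q : ℕ) [Fact q.Prime] (hq : 5 ≤ q) (k : ℕ) (s : ℤˣ) :
    (CuspRep.quadChar q (-1) ≠ (-1) ^ k →
      CuspRep.cuspFormsRep q k (CuspRep.rhoQuad q s) = ⊥) ∧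
    (CuspRep.quadChar q (-1) = (-1) ^ k →
      FiniteDimensional ℂ (CuspRep.cuspFormsRep q k (CuspRep.rhoQuad q s)) ∧
      FiniteDimensional ℂ (CuspRep.cuspFormsGamma0 q k (CuspRep.quadChar q)) ∧
      (∀ n : (ZMod q)ˣ, FiniteDimensional ℂ (CuspRep.cuspFormsGamma1 q k (n : ZMod q))) ∧
      (Module.finrank ℂ (CuspRep.cuspFormsRep q k (CuspRep.rhoQuad q s)) : ℂ) =
        1 / 2 * (Module.finrank ℂ (CuspRep.cuspFormsGamma0 q k (CuspRep.quadChar q)) : ℂ) +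
        ((s : ℤ) : ℂ) * (CuspRep.quadChar q (-1) / ((q : ℂ) - 1) *
          ∑ n : (ZMod q)ˣ, CuspRep.quadChar q (n : ZMod q) *
            (Module.finrank ℂ (CuspRep.cuspFormsGamma1 q k (n : ZMod q)) : ℂ))) := by
  have hq2 : q ≠ 2 := by omega
  refine ⟨CuspRep.cuspFormsRep_eq_bot, fun h => ?_⟩
  let e := CuspRep.heckeEigenEquiv (k := (k : ℤ)) (s := s) hq2
  let e₀ := CuspRep.cuspFormsGamma0Equiv (q := q) (k := (k : ℤ))
  refine ⟨e.finiteDimensional, e₀.symm.finiteDimensional, fun n => inferInstance, ?_⟩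
  have key := CuspRep.finrank_heckeEigen (CuspRep.formsRep q k) hq2 (CuspRep.formsRep_neg_one h)
    (CuspRep.signedRoot_sq hq2 s) (CuspRep.signedRoot_ne_zero hq2 s)
  -- The Gauss sum is the positive signed root, so its quotient by `signedRoot q s` is `s⁻¹ = s`.
  have hs : gaussSum (CuspRep.quadChar q) ZMod.stdAddChar / CuspRep.signedRoot q s =
      ((s : ℤ) : ℂ) := by
    have h0 := CuspRep.signedRoot_ne_zero hq2 s
    rw [div_eq_iff h0, CuspRep.gaussSum_quadChar hq2, CuspRep.signedRoot, ← mul_assoc]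
    rcases Int.units_eq_one_or s with rfl | rfl <;> simp
  rw [hs, e.finrank_eq, ← e₀.finrank_eq] at key
  have hn (n : (ZMod q)ˣ) : Module.finrank ℂ (CuspRep.cuspFormsGamma1 q k (n : ZMod q)) =
      Module.finrank ℂ (CuspRep.unipotentEigen (CuspRep.formsRep q k) (n : ZMod q)) := by
    rw [CuspRep.cuspFormsGamma1_eq]
  simp only [hn]
  exact key
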